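/- **Setting.** Let $V:\mathbb R^3\to[0,\infty)$ be a radial integrable function that is not almost everywhere zero, with Fourier transform $\widehat V(p)=\int_{\mathbb R^3}e^{-ipx}V(x)\,dx$. Assume that $\widehat V\ge 0$, $\widehat V\in C^1(\mathbb R^3)\cap L^1(\mathbb R^3)\cap L^\infty(\mathbb R^3)$ and $\nabla\widehat V\in L^2\cap L^\infty$. Let $\mathcal D'$ be the set of pairs $(\gamma,\alpha)$ of measurable real functions on $\mathbb R^3$ with $\gamma\in L^1((1+p^2)dp)$, $\gamma\ge 0$ and $\alpha^2\le\gamma(\gamma+1)$ almost everywhere, and let $\mathcal D=\{(\gamma,\alpha,\rho_0):(\gamma,\alpha)\in\mathcal D',\ \rho_0\ge 0\}$. Put $\rho_\gamma=(2\pi)^{-3}\int\gamma$ and $\rho=\rho_0+\rho_\gamma$. At temperature $T=0$ the canonical functional is $$\mathcal F^{\rm can}(\gamma,\alpha,\rho_0)=(2\pi)^{-3}\!\int p^2\gamma(p)\,dp+\tfrac12\widehat V(0)\rho^2+\rho_0(2\pi)^{-3}\!\int\widehat V(\gamma+\alpha)\,dp+\tfrac12(2\pi)^{-6}\!\iint\widehat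 V(p-q)\big(\alpha(p)\alpha(q)+\gamma(p)\gamma(q)\big)\,dp\,dq ,$$ and for $\mu\in\mathbb R$ the grand canonical functional is $\mathcal F=\mathcal F^{\rm can}-\mu\rho$. A grand canonical minimizer is a minimizer of $\mathcal F$ on $\mathcal D$. For a given density $\bar\rho\ge0$, a canonical minimizer is a minimizer of $\mathcal F^{\rm can}$ on $\{(\gamma,\alpha,\rho_0)\in\mathcal D:\rho_0+\rho_\gamma=\bar\rho\}$. **States.** Consider the Weyl $*$-algebra over the test functions $f\in\mathcal S(\mathbb R^3)$ (in momentum space), spanned by linearly independent $W(f)$ with $W(f)W(g)=e^{-\frac i2\operatorname{Im}\langle f,g\rangle}W(f+g)$ and $W(f)^*=W(-f)$. A state is a linear functional $\omega$ with $\omega(1)=1$ and $\omega(a^*a)\ge0$ for all $a$. It is pure if it is an extreme point of the convex set of states. Let $\omega_{\gamma,\alpha}$ be the quasi-free (centred Gaussian) functional with momentum distribution $\gamma$ and pairing function $\alpha$, $$\omega_{\gamma,\alpha}(W(f))=\exp\Big(-\tfrac14\int\big[(1+2\gamma(p))|f(p)|^2+2\alpha(p)\operatorname{Re}(f(p)f(-p))\big]dp\Big),$$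 and let $\omega_{\gamma,\alpha,\rho_0}(W(f))=\omega_{\gamma,\alpha}(W(f))\,e^{i\sqrt2(2\pi)^{3/2}\sqrt{\rho_0}\operatorname{Re}f(0)}$ be its translate by the condensate. **Claim.** (i) Let $\mu\in\mathbb R$, and let $(\gamma,\alpha,\rho_0)$ be a grand canonical minimizer at $T=0$. Then $\omega_{\gamma,\alpha}$ is a pure quasi-free state, $\omega_{\gamma,\alpha,\rho_0}$ is a pure state, and $\alpha^2=\gamma(\gamma+1)$ almost everywhere. (ii) The same conclusions hold for every canonical minimizer at $T=0$, for every density $\bar\rho\ge0$. (iii) The two properties are equivalent: for every $(\gamma,\alpha)\in\mathcal D'$ with $\gamma(-p)=\gamma(p)$ and $\alpha(-p)=\alpha(p)$ almost everywhere, $\omega_{\gamma,\alpha}$ is a pure state if and only if $\alpha^2=\gamma(\gamma+1)$ almost everywhere. -/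

import Mathlib

open MeasureTheory
open scoped SchwartzMap

noncomputable section

namespace BogoliubovGas

/-- Position or momentum space `ℝ³` with its Euclidean norm. -/
abbrev E3 : Type := EuclideanSpace ℝ (Fin 3)

/-! ## The interaction potential -/

/-- The Fourier transform `∫ e^{-ipx} V(x) dx`, as a complex number. -/
def fourierC (V : E3 → ℝ) (p : E3) : ℂ :=
  ∫ x, Complex.exp (-(Complex.I * ((inner ℝ p x : ℝ) : ℂ))) * (V x : ℂ)

/-- `V` is radial. -/
def IsRadial (V : E3 → ℝ) : Prop := ∀ x y : E3, ‖x‖ = ‖y‖ → V x = V y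

/-- The Fourier transform of a radial potential is real, so nothing is lost below by working with
its real part. -/
theorem fourierC_im_eq_zero {V : E3 → ℝ} (hV : IsRadial V) (p : E3) : (fourierC V p).im = 0 := by
  have h : (starRingEnd ℂ) (fourierC V p) = fourierC V p := by
    unfold fourierC
    rw [← integral_conj, ← integral_neg_eq_self]
    refine integral_congr_ae (Filter.Eventually.of_forall fun x => ?_)
    have hx : V (-x) = V x := hV _ _ (norm_neg x)
    simp only [map_mul, ← Complex.exp_conj, map_neg, Complex.conj_I, Complex.conj_ofReal,
      inner_neg_right, hx, Complex.ofReal_neg]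
    congr 2
    ring
  exact Complex.conj_eq_iff_im.mp h

/-- The Fourier transform `V̂` of a (radial) potential, as a real function. -/
def vhat (V : E3 → ℝ) (p : E3) : ℝ := (fourierC V p).re

/-- The assumptions on the interaction potential.  (`V̂` is radial as soon as `V` is.) -/
structure Admissible (V : E3 → ℝ) : Prop where
  integrable : Integrable V
  radial : IsRadial V
  nonneg : ∀ x, 0 ≤ V x
  vhat_nonneg : ∀ p, 0 ≤ vhat V p
  not_zero : ¬ (V =ᵐ[volume] 0)
  vhat_contDiff : ContDiff ℝ 1 (vhat V)
  vhat_integrable : Integrable (vhat V)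
  vhat_bounded : MemLp (vhat V) ⊤
  grad_sq_integrable : MemLp (gradient (vhat V)) 2
  grad_bounded : MemLp (gradient (vhat V)) ⊤

/-! ## The free energy functionals -/

/-- `(2π)⁻³`. -/
def c3 : ℝ := ((2 * Real.pi) ^ 3)⁻¹

/-- `ρ_γ = (2π)⁻³ ∫ γ(p) dp`. -/
def rhoGamma (γ : E3 → ℝ) : ℝ := c3 * ∫ p, γ p

/-- `β(p) = √((1/2 + γ(p))² - α(p)²)`. -/
def beta (γ α : E3 → ℝ) (p : E3) : ℝ := Real.sqrt ((1 / 2 + γ p) ^ 2 - α p ^ 2)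

/-- `s(β) = (β + 1/2) ln (β + 1/2) - (β - 1/2) ln (β - 1/2)`. -/
def entropyDensity (b : ℝ) : ℝ :=
  (b + 1 / 2) * Real.log (b + 1 / 2) - (b - 1 / 2) * Real.log (b - 1 / 2)

/-- The entropy `S(γ, α)`. -/
def entropy (γ α : E3 → ℝ) : ℝ := c3 * ∫ p, entropyDensity (beta γ α p)

/-- Triples `(γ, α, ρ₀)`. -/
abbrev Triple : Type := (E3 → ℝ) × (E3 → ℝ) × ℝ

/-- The set `𝒟'` of pairs `(γ, α)` with `γ ∈ L¹((1+p²)dp)`, `γ ≥ 0`, `α² ≤ γ(γ+1)`; `α` is a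
measurable function, and inequalities between functions hold almost everywhere. -/
def domainPair : Set ((E3 → ℝ) × (E3 → ℝ)) :=
  {x | Integrable (fun p => (1 + ‖p‖ ^ 2) * x.1 p) ∧ AEStronglyMeasurable x.2 volume ∧
    (∀ᵐ p, 0 ≤ x.1 p) ∧ ∀ᵐ p, x.2 p ^ 2 ≤ x.1 p * (x.1 p + 1)}

/-- The domain `𝒟`: triples `(γ, α, ρ₀)` with `(γ, α) ∈ 𝒟'` and `ρ₀ ≥ 0`. -/
def domain : Set Triple := {x | (x.1, x.2.1) ∈ domainPair ∧ 0 ≤ x.2.2}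

/-- The total density `ρ = ρ₀ + ρ_γ`. -/
def density (x : Triple) : ℝ := x.2.2 + rhoGamma x.1

/-- The canonical free energy functional at temperature `T`. -/
def freeEnergyCan (V : E3 → ℝ) (T : ℝ) : Triple → ℝ := fun x =>
  let γ := x.1
  let α := x.2.1
  let ρ₀ := x.2.2
  c3 * (∫ p, ‖p‖ ^ 2 * γ p) - T * entropy γ α + vhat V 0 / 2 * density x ^ 2
    + ρ₀ * (c3 * ∫ p, vhat V p * (γ p + α p))
    + 1 / 2 * (c3 ^ 2 * ∫ z : E3 × E3, vhat V (z.1 - z.2) * (α z.1 * α z.2 + γ z.1 * γ z.2))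

/-- The grand canonical free energy functional at temperature `T` and chemical potential `μ`. -/
def freeEnergy (V : E3 → ℝ) (T μ : ℝ) : Triple → ℝ := fun x =>
  freeEnergyCan V T x - μ * density x

/-- `x` is a minimizer of the grand canonical problem. -/
def IsGrandCanonicalMinimizer (V : E3 → ℝ) (T μ : ℝ) (x : Triple) : Prop :=
  x ∈ domain ∧ IsMinOn (freeEnergy V T μ) domain x

/-- The domain of the canonical problem at density `ρ`: triples in `𝒟` with `ρ₀ = ρ - ρ_γ`. -/
def canonicalDomain (ρ : ℝ) : Set Triple := {x | x ∈ domain ∧ x.2.2 = ρ - rhoGamma x.1}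

/-- `x` is a minimizer of the canonical problem. -/
def IsCanonicalMinimizer (V : E3 → ℝ) (T ρ : ℝ) (x : Triple) : Prop :=
  x ∈ canonicalDomain ρ ∧ IsMinOn (freeEnergyCan V T) (canonicalDomain ρ) x

/-! ## States of the infinite Bose gas

The observables are those of the Weyl (CCR) algebra over the one-particle test functions
`f ∈ 𝓢(ℝ³)`, written in momentum space.  The generator `W(f)` stands for
`exp (i (a(f) + a*(f)) / √2)`. -/

/-- The symplectic form `Im ⟨f, g⟩_{L²}`. -/
def symp (f g : 𝓢(E3, ℂ)) : ℝ := (∫ p, (starRingEnd ℂ) (f p) * g p).im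

/-- Elements of the Weyl algebra: finite linear combinations `∑ c_f W(f)`. -/
abbrev Weyl : Type := 𝓢(E3, ℂ) →₀ ℂ

/-- The Weyl operator `W(f)`. -/
def weylOp (f : 𝓢(E3, ℂ)) : Weyl := Finsupp.single f 1

/-- The product of the Weyl algebra, the bilinear extension of
`W(f) W(g) = e^{-i Im⟨f,g⟩/2} W(f+g)`. -/
def weylMul (a b : Weyl) : Weyl :=
  a.sum fun f c => b.sum fun g d =>
    Finsupp.single (f + g) (c * d * Complex.exp (-(Complex.I * ((symp f g : ℝ) : ℂ) / 2)))

/-- The involution of the Weyl algebra, the antilinear extension of `W(f)* = W(-f)`. -/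
def weylStar (a : Weyl) : Weyl :=
  a.sum fun f c => Finsupp.single (-f) ((starRingEnd ℂ) c)

/-- States: linear functionals `ω` on the Weyl algebra with `ω(1) = 1` and `ω(a* a) ≥ 0`. -/
def states : Set (Weyl →ₗ[ℂ] ℂ) :=
  {ω | ω (weylOp 0) = 1 ∧
    ∀ a : Weyl, 0 ≤ (ω (weylMul (weylStar a) a)).re ∧ (ω (weylMul (weylStar a) a)).im = 0}

/-- A pure state: an extreme point of the convex set of states. -/
def IsPureState (ω : Weyl →ₗ[ℂ] ℂ) : Prop := ω ∈ Set.extremePoints ℝ states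

/-- The variance `ω((a(f) + a*(f))²)` in the state with
`ω(a*(p) a(q)) = γ(p) δ(p-q)` and `ω(a(p) a(-q)) = α(p) δ(p-q)`, that is, `⟨F, Γ F⟩` for the
one-particle density matrix `Γ` of the state and `F = f ⊕ Jf`. -/
def variance (γ α : E3 → ℝ) (f : 𝓢(E3, ℂ)) : ℝ :=
  ∫ p, ((1 + 2 * γ p) * ‖f p‖ ^ 2 + 2 * α p * (f p * f (-p)).re)

/-- The Bogoliubov variational functional `ω_{γ,α,ρ₀}`: the quasi-free (centred Gaussian) functional
`ω_{γ,α}` with the momentum distribution `γ` and the pairing function `α`, shifted by the constant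
condensate wave function `√ρ₀` (`a(f) ↦ a(f) + ⟨f, √ρ₀⟩`; in the unitary normalization of the
Fourier transform `⟨f, √ρ₀⟩` is the conjugate of `(2π)^{3/2} √ρ₀ f(0)`). -/
def bogoliubovState (γ α : E3 → ℝ) (ρ₀ : ℝ) : Weyl →ₗ[ℂ] ℂ :=
  Finsupp.linearCombination ℂ fun f =>
    Complex.exp (((-(variance γ α f / 4) : ℝ) : ℂ) + Complex.I *
      ((Real.sqrt 2 * (2 * Real.pi) ^ (3 / 2 : ℝ) * Real.sqrt ρ₀ * (f 0).re : ℝ) : ℂ))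

/-- The quasi-free functional `ω_{γ,α}` with one-particle density matrix given by `γ` and `α`. -/
def quasiFreeState (γ α : E3 → ℝ) : Weyl →ₗ[ℂ] ℂ := bogoliubovState γ α 0

/-- Reflection symmetry `g(-p) = g(p)` for almost every `p`. -/
def IsEvenAE (g : E3 → ℝ) : Prop := ∀ᵐ p : E3, g (-p) = g p

/-- Pointwise (almost everywhere) purity relation `α² = γ(γ+1)`. -/
def PurityRelation (γ α : E3 → ℝ) : Prop := ∀ᵐ p : E3, α p ^ 2 = γ p * (γ p + 1)

end BogoliubovGas

end

open scoped ComplexOrder Topology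

noncomputable section

namespace BogoliubovGas

/-! ## The Fourier transform of the potential -/

/-! There are two independent halves: minimizers saturate the constraint and are even, and for even
pairs saturation is equivalent to purity of the Gaussian state.

Saturation. `V ≥ 0` makes the interaction form of `α` and of `γ` nonnegative, while `V̂ ≥ 0` makes
the terms in `γ` monotone. The sign of `∫ V̂ (γ + α)` settles what to do at fixed density. If it is
nonnegative, putting all particles in the condensate costs nothing, so the kinetic energy of a
minimizer vanishes and `γ = α = 0`. If it is negative, one keeps `α`, lowers `γ` to the least value
compatible with it and adds the excess to the condensate; no term increases, and equality of kinetic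
energies forces `γ` to have been that least value (`IsMinimalAtDensity.purityRelation`). Evenness
follows by averaging with the reflection: the average is again minimal, hence saturated, and strict
convexity of the constraint set excludes an average of two different points
(`IsMinimalAtDensity.even`).

Purity from saturation. Suppose a Gaussian state `ω` with covariance `K` dominates a multiple of a
state `φ`. The ratio `F(f) = φ(W(f)) / ω(W(f))` then inherits a first-order estimate: along `ξ = h +
i k` its antiholomorphic increment is controlled by `K(ξ, ξ)`. Since `F(-f)` is the conjugate of
`F(f)`, the holomorphic increment obeys the same bound, so the increment along `h` alone is small.
If for every `h` some `k` makes `K(ξ, ξ)` arbitrarily small, all directional derivatives of `F`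
vanish and `φ = ω` (`isPureState_gaussianFunctional`). Saturation says that the two-by-two density
matrix at each momentum is singular; its null vectors, truncated and approximated by Schwartz
functions, supply `k` (`exists_kernel_defect_lt`).

Saturation from purity. Where the inequality is strict, the density matrix dominates a positive
multiple of the identity, so a real rank-one kernel can be subtracted from `K` without losing
positivity. The state is then a Gaussian average of displaced states, and reweighting this average
by `1 ± sin` decomposes it nontrivially (`not_isPureState_gaussianFunctional`). -/

theorem vhat_eq {V : E3 → ℝ} (hV : Admissible V) (p : E3) :
    vhat V p = ∫ x, Real.cos (inner ℝ p x) * V x := by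
  have hi : Integrable fun x => Complex.exp (-(Complex.I * ((inner ℝ p x : ℝ) : ℂ))) * (V x : ℂ) := by
    refine hV.integrable.norm.mono' ?_ (Filter.Eventually.of_forall fun x => ?_)
    · exact (Continuous.aestronglyMeasurable (by fun_prop)).mul
        (Complex.continuous_ofReal.comp_aestronglyMeasurable hV.integrable.1)
    · rw [norm_mul, ← mul_neg, mul_comm, ← Complex.ofReal_neg, mul_comm Complex.I,
        Complex.norm_exp_ofReal_mul_I, mul_one, Complex.norm_real]
  have h1 : (fourierC V p).re = ∫ x, (Complex.exp (-(Complex.I * ((inner ℝ p x : ℝ) : ℂ))) *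
      (V x : ℂ)).re := (integral_re hi).symm
  rw [vhat, h1]
  refine integral_congr_ae (Filter.Eventually.of_forall fun x => ?_)
  simp only [Complex.re_mul_ofReal]
  rw [Complex.exp_re]
  simp

theorem vhat_neg {V : E3 → ℝ} (hV : Admissible V) (p : E3) : vhat V (-p) = vhat V p := by
  simp [vhat_eq hV]

theorem abs_vhat_le {V : E3 → ℝ} (hV : Admissible V) (p : E3) : |vhat V p| ≤ ∫ x, |V x| := by
  rw [vhat_eq hV, ← Real.norm_eq_abs]
  refine norm_integral_le_of_norm_le hV.integrable.norm (Filter.Eventually.of_forall fun x => ?_)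
  rw [norm_mul, Real.norm_eq_abs, Real.norm_eq_abs]
  exact mul_le_of_le_one_left (abs_nonneg _) (Real.abs_cos_le_one _)

theorem continuous_vhat {V : E3 → ℝ} (hV : Admissible V) : Continuous (vhat V) :=
  hV.vhat_contDiff.continuous

/-- A relaxed version of the constraint on pairs, without decay at large momenta. -/
structure IsPair (g a : E3 → ℝ) : Prop where
  integrable : Integrable g
  measurable : AEStronglyMeasurable a volume
  nonneg : ∀ᵐ p, 0 ≤ g p
  le : ∀ᵐ p, a p ^ 2 ≤ g p * (g p + 1)

theorem abs_le_add_half {g a : ℝ} (hg : 0 ≤ g) (h : a ^ 2 ≤ g * (g + 1)) : |a| ≤ g + 1 / 2 :=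
  abs_le_of_sq_le_sq (by nlinarith) (by linarith)

/-- The product `g(g+1)h(h+1)` falls short of the square of `gh + (g+h)/2` by exactly `(g-h)²/4`.
This bound is both the integrable majorant of the interaction and the source of strict convexity. -/
theorem abs_mul_le_of_constraint {g h a b : ℝ} (hg : 0 ≤ g) (hh : 0 ≤ h) (ha : a ^ 2 ≤ g * (g + 1))
    (hb : b ^ 2 ≤ h * (h + 1)) : |a * b| ≤ g * h + (g + h) / 2 := by
  refine abs_le_of_sq_le_sq ?_ (by positivity)
  have h1 := mul_le_mul ha hb (sq_nonneg b) (by positivity)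
  nlinarith [sq_nonneg (g - h)]

/-- Since `g² ≤ g(g+1)`, the function `g` may play the role of `a`, so every estimate for `α` also
covers the terms in `γ`. -/
theorem IsPair.self {g a : E3 → ℝ} (h : IsPair g a) : IsPair g g where
  integrable := h.integrable
  measurable := h.integrable.1
  nonneg := h.nonneg
  le := by
    filter_upwards [h.nonneg] with p hp
    nlinarith

/-! ### The interaction form and its positivity -/

/-- The interaction `∬ V̂(p-q) f(p) f(q) dp dq`. -/
def pairInteraction (V f : E3 → ℝ) : ℝ := ∫ z : E3 × E3, vhat V (z.1 - z.2) * (f z.1 * f z.2)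

theorem ae_prod_fst {P : E3 → Prop} (h : ∀ᵐ p, P p) : ∀ᵐ z : E3 × E3, P z.1 :=
  Measure.quasiMeasurePreserving_fst.ae h

theorem ae_prod_snd {P : E3 → Prop} (h : ∀ᵐ p, P p) : ∀ᵐ z : E3 × E3, P z.2 :=
  Measure.quasiMeasurePreserving_snd.ae h

/-- The product part needs only that `V̂` is bounded, and the half-sum is a convolution integrand
with `V̂ ∈ L¹`. This matters because `α` itself need not be integrable. -/
theorem integrable_pairMajorant {V : E3 → ℝ} (hV : Admissible V) {g : E3 → ℝ}
    (hg : Integrable g) : Integrable fun z : E3 × E3 =>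
      vhat V (z.1 - z.2) * (g z.1 * g z.2 + (g z.1 + g z.2) / 2) := by
  have h1 : Integrable fun z : E3 × E3 => g z.2 * vhat V (z.1 - z.2) :=
    hg.convolution_integrand (ContinuousLinearMap.mul ℝ ℝ) hV.vhat_integrable
  have h2 : Integrable fun z : E3 × E3 => g z.1 * vhat V (z.1 - z.2) := by
    refine h1.swap.congr (Filter.Eventually.of_forall fun z => ?_)
    simp only [Function.comp, Prod.snd_swap, Prod.fst_swap]
    rw [← vhat_neg hV, neg_sub]
  have h3 : Integrable fun z : E3 × E3 => vhat V (z.1 - z.2) * (g z.1 * g z.2) :=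
    (hg.mul_prod hg).bdd_mul
      ((continuous_vhat hV).comp (continuous_fst.sub continuous_snd)).aestronglyMeasurable
      (Filter.Eventually.of_forall fun z => abs_vhat_le hV _)
  refine (h3.add ((h1.add h2).div_const 2)).congr (Filter.Eventually.of_forall fun z => ?_)
  simp only [Pi.add_apply]
  ring

theorem aestronglyMeasurable_pair {V : E3 → ℝ} (hV : Admissible V) {a : E3 → ℝ}
    (ha : AEStronglyMeasurable a volume) : AEStronglyMeasurable
      (fun z : E3 × E3 => vhat V (z.1 - z.2) * (a z.1 * a z.2)) volume :=
  ((continuous_vhat hV).comp (continuous_fst.sub continuous_snd)).aestronglyMeasurable.mul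
    ((ha.comp_quasiMeasurePreserving Measure.quasiMeasurePreserving_fst).mul
      (ha.comp_quasiMeasurePreserving Measure.quasiMeasurePreserving_snd))

theorem IsPair.norm_le {V : E3 → ℝ} (hV : Admissible V) {g a : E3 → ℝ} (h : IsPair g a) :
    ∀ᵐ z : E3 × E3, ‖vhat V (z.1 - z.2) * (a z.1 * a z.2)‖ ≤
      vhat V (z.1 - z.2) * (g z.1 * g z.2 + (g z.1 + g z.2) / 2) := by
  filter_upwards [ae_prod_fst h.nonneg, ae_prod_snd h.nonneg, ae_prod_fst h.le,
    ae_prod_snd h.le] with z h1 h2 h3 h4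
  rw [norm_mul, Real.norm_of_nonneg (hV.vhat_nonneg _), Real.norm_eq_abs]
  exact mul_le_mul_of_nonneg_left (abs_mul_le_of_constraint h1 h2 h3 h4) (hV.vhat_nonneg _)

theorem IsPair.integrable_pair {V : E3 → ℝ} (hV : Admissible V) {g a : E3 → ℝ} (h : IsPair g a) :
    Integrable fun z : E3 × E3 => vhat V (z.1 - z.2) * (a z.1 * a z.2) :=
  (integrable_pairMajorant hV h.integrable).mono' (aestronglyMeasurable_pair hV h.measurable)
    (h.norm_le hV)

/-- Writing `V̂` as a cosine transform and exchanging integrals gives `∫ V(x) (|∫ a cos|² + |∫ a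
sin|²) dx`, where `V ≥ 0` decides the sign. -/
theorem pairInteraction_nonneg_of_integrable {V : E3 → ℝ} (hV : Admissible V) {a : E3 → ℝ}
    (ha : Integrable a) : 0 ≤ pairInteraction V a := by
  have hF : Integrable (Function.uncurry fun (z : E3 × E3) (x : E3) =>
      Real.cos (inner ℝ (z.1 - z.2) x) * (a z.1 * a z.2 * V x))
      ((volume : Measure (E3 × E3)).prod volume) := by
    refine ((ha.mul_prod ha).mul_prod hV.integrable).bdd_mul (c := 1) ?_
      (Filter.Eventually.of_forall fun y => ?_)
    · exact Continuous.aestronglyMeasurable (by fun_prop)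
    · exact Real.abs_cos_le_one _
  have hcos : ∀ x : E3, Integrable fun p : E3 => Real.cos (inner ℝ p x) * a p := fun x =>
    ha.bdd_mul (c := 1) (Continuous.aestronglyMeasurable (by fun_prop))
      (Filter.Eventually.of_forall fun y => Real.abs_cos_le_one _)
  have hsin : ∀ x : E3, Integrable fun p : E3 => Real.sin (inner ℝ p x) * a p := fun x =>
    ha.bdd_mul (c := 1) (Continuous.aestronglyMeasurable (by fun_prop))
      (Filter.Eventually.of_forall fun y => Real.abs_sin_le_one _)
  have h1 : pairInteraction V a = ∫ z : E3 × E3, ∫ x : E3,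
      Real.cos (inner ℝ (z.1 - z.2) x) * (a z.1 * a z.2 * V x) := by
    refine integral_congr_ae (Filter.Eventually.of_forall fun z => ?_)
    simp only [vhat_eq hV]
    rw [← integral_mul_const]
    refine integral_congr_ae (Filter.Eventually.of_forall fun x => ?_)
    ring
  rw [h1, integral_integral_swap hF]
  refine integral_nonneg fun x => ?_
  have h2 : ∫ z : E3 × E3, Real.cos (inner ℝ (z.1 - z.2) x) * (a z.1 * a z.2 * V x) =
      ((∫ p, Real.cos (inner ℝ p x) * a p) * (∫ p, Real.cos (inner ℝ p x) * a p) +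
        (∫ p, Real.sin (inner ℝ p x) * a p) * (∫ p, Real.sin (inner ℝ p x) * a p)) * V x := by
    rw [← integral_prod_mul, ← integral_prod_mul, ← integral_add ((hcos x).mul_prod (hcos x))
      ((hsin x).mul_prod (hsin x)), ← integral_mul_const]
    refine integral_congr_ae (Filter.Eventually.of_forall fun z => ?_)
    simp only [inner_sub_left, Real.cos_sub]
    ring
  simp only [Pi.zero_apply]
  rw [h2]
  exact mul_nonneg (add_nonneg (mul_self_nonneg _) (mul_self_nonneg _)) (hV.nonneg x)

/-- Truncation to balls makes `a` integrable because `|a| ≤ g + 1/2`; the common majorant lets the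
truncation be removed by dominated convergence. -/
theorem IsPair.pairInteraction_nonneg {V : E3 → ℝ} (hV : Admissible V) {g a : E3 → ℝ}
    (h : IsPair g a) : 0 ≤ pairInteraction V a := by
  set t : ℕ → E3 → ℝ := fun n => (Metric.closedBall (0 : E3) n).indicator a with ht
  have hti : ∀ n, Integrable (t n) := by
    intro n
    have hb : MeasurableSet (Metric.closedBall (0 : E3) n) := Metric.isClosed_closedBall.measurableSet
    rw [ht, integrable_indicator_iff hb]
    have hfin : volume (Metric.closedBall (0 : E3) n) ≠ ⊤ := measure_closedBall_lt_top.ne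
    refine Integrable.mono' (h.integrable.integrableOn.add
      (integrableOn_const (C := (1 / 2 : ℝ)) hfin)) h.measurable.restrict ?_
    filter_upwards [ae_restrict_of_ae h.nonneg, ae_restrict_of_ae h.le] with p h0 h1
    exact abs_le_add_half h0 h1
  have hlim : Filter.Tendsto (fun n => pairInteraction V (t n)) Filter.atTop
      (𝓝 (pairInteraction V a)) := by
    refine tendsto_integral_of_dominated_convergence _
      (fun n => aestronglyMeasurable_pair hV (hti n).1) (integrable_pairMajorant hV h.integrable)
      (fun n => ?_) (Filter.Eventually.of_forall fun z => ?_)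
    · filter_upwards [h.norm_le hV] with z hz
      refine le_trans ?_ hz
      simp only [norm_mul]
      refine mul_le_mul_of_nonneg_left (mul_le_mul (norm_indicator_le_norm_self _ _)
        (norm_indicator_le_norm_self _ _) (norm_nonneg _) (norm_nonneg _)) (norm_nonneg _)
    · obtain ⟨N, hN⟩ := exists_nat_ge (max ‖z.1‖ ‖z.2‖)
      refine tendsto_const_nhds.congr' ?_
      filter_upwards [Filter.eventually_ge_atTop N] with n hn
      have hNn : (N : ℝ) ≤ n := by exact_mod_cast hn
      have m1 : z.1 ∈ Metric.closedBall (0 : E3) n := by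
        simpa using (le_max_left _ _).trans (hN.trans hNn)
      have m2 : z.2 ∈ Metric.closedBall (0 : E3) n := by
        simpa using (le_max_right _ _).trans (hN.trans hNn)
      simp only [ht, Set.indicator_of_mem m1, Set.indicator_of_mem m2]
  exact ge_of_tendsto' hlim fun n => pairInteraction_nonneg_of_integrable hV (hti n)

/-! ## The canonical functional at zero temperature -/

theorem integrable_of_weighted {g : E3 → ℝ}
    (h : Integrable fun p => (1 + ‖p‖ ^ 2) * g p) : Integrable g := by
  have hpos : ∀ p : E3, (0 : ℝ) < 1 + ‖p‖ ^ 2 := fun p => by positivity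
  have := h.bdd_mul (c := 1) (f := fun p : E3 => (1 + ‖p‖ ^ 2)⁻¹)
    (Continuous.aestronglyMeasurable (by fun_prop (disch := intro p; exact (hpos p).ne')))
    (Filter.Eventually.of_forall fun p => by
      rw [Real.norm_of_nonneg (inv_nonneg.mpr (hpos p).le)]
      exact inv_le_one_of_one_le₀ (by nlinarith [sq_nonneg ‖p‖]))
  refine this.congr (Filter.Eventually.of_forall fun p => ?_)
  simp only
  rw [← mul_assoc, inv_mul_cancel₀ (hpos p).ne', one_mul]

theorem integrable_kinetic {g : E3 → ℝ}
    (h : Integrable fun p => (1 + ‖p‖ ^ 2) * g p) : Integrable fun p => ‖p‖ ^ 2 * g p := by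
  refine (h.sub (integrable_of_weighted h)).congr (Filter.Eventually.of_forall fun p => ?_)
  simp only [Pi.sub_apply]
  ring

theorem isPair_of_mem {γ α : E3 → ℝ} (h : (γ, α) ∈ domainPair) : IsPair γ α :=
  ⟨integrable_of_weighted h.1, h.2.1, h.2.2.1, h.2.2.2⟩

theorem c3_pos : 0 < c3 := by
  unfold c3
  positivity

theorem IsPair.integrable_vhat_mul {V : E3 → ℝ} (hV : Admissible V) {g a : E3 → ℝ}
    (h : IsPair g a) : Integrable fun p => vhat V p * a p := by
  have h1 : Integrable fun p => vhat V p * g p :=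
    h.integrable.bdd_mul (continuous_vhat hV).aestronglyMeasurable
      (Filter.Eventually.of_forall fun p => abs_vhat_le hV p)
  refine (h1.add (hV.vhat_integrable.div_const 2)).mono'
    ((continuous_vhat hV).aestronglyMeasurable.mul h.measurable) ?_
  filter_upwards [h.nonneg, h.le] with p h2 h3
  rw [norm_mul, Real.norm_of_nonneg (hV.vhat_nonneg p), Real.norm_eq_abs]
  have := mul_le_mul_of_nonneg_left (abs_le_add_half h2 h3) (hV.vhat_nonneg p)
  simp only [Pi.add_apply]
  linarith

theorem freeEnergyCan_zero_eq {V : E3 → ℝ} (hV : Admissible V) {γ α : E3 → ℝ}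
    (h : IsPair γ α) (ρ₀ : ℝ) : freeEnergyCan V 0 (γ, α, ρ₀) =
      c3 * (∫ p, ‖p‖ ^ 2 * γ p) + vhat V 0 / 2 * density (γ, α, ρ₀) ^ 2 +
      ρ₀ * (c3 * ((∫ p, vhat V p * γ p) + ∫ p, vhat V p * α p)) +
      1 / 2 * (c3 ^ 2 * (pairInteraction V α + pairInteraction V γ)) := by
  have e1 : ∫ p, vhat V p * (γ p + α p) = (∫ p, vhat V p * γ p) + ∫ p, vhat V p * α p := by
    rw [← integral_add (h.self.integrable_vhat_mul hV) (h.integrable_vhat_mul hV)]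
    refine integral_congr_ae (Filter.Eventually.of_forall fun p => ?_)
    ring
  have e2 : ∫ z : E3 × E3, vhat V (z.1 - z.2) * (α z.1 * α z.2 + γ z.1 * γ z.2) =
      pairInteraction V α + pairInteraction V γ := by
    rw [pairInteraction, pairInteraction,
      ← integral_add (h.integrable_pair hV) (h.self.integrable_pair hV)]
    refine integral_congr_ae (Filter.Eventually.of_forall fun p => ?_)
    ring
  simp only [freeEnergyCan, e1, e2, zero_mul, sub_zero]

/-! ### Minimality at fixed density and saturation of the constraint -/

/-- `x` minimizes the canonical functional among all triples of the same density. -/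
def IsMinimalAtDensity (V : E3 → ℝ) (x : Triple) : Prop :=
  x ∈ domain ∧ ∀ y ∈ domain, density y = density x → freeEnergyCan V 0 x ≤ freeEnergyCan V 0 y

theorem IsGrandCanonicalMinimizer.isMinimalAtDensity {V : E3 → ℝ} {μ : ℝ} {x : Triple}
    (h : IsGrandCanonicalMinimizer V 0 μ x) : IsMinimalAtDensity V x := by
  refine ⟨h.1, fun y hy hd => ?_⟩
  have := h.2 hy
  simp only [freeEnergy, Set.mem_ofPred_eq, hd] at this
  linarith

theorem IsCanonicalMinimizer.isMinimalAtDensity {V : E3 → ℝ} {ρ : ℝ} {x : Triple}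
    (h : IsCanonicalMinimizer V 0 ρ x) : IsMinimalAtDensity V x := by
  refine ⟨h.1.1, fun y hy hd => h.2 ⟨hy, ?_⟩⟩
  have h1 := h.1.2
  simp only [density] at hd
  linarith

theorem rhoGamma_nonneg {γ : E3 → ℝ} (h : ∀ᵐ p, 0 ≤ γ p) : 0 ≤ rhoGamma γ :=
  mul_nonneg c3_pos.le (integral_nonneg_of_ae h)

theorem ae_eq_zero_of_kinetic {g : E3 → ℝ} (h0 : ∀ᵐ p, 0 ≤ g p)
    (hi : Integrable fun p => ‖p‖ ^ 2 * g p) (h : ∫ p, ‖p‖ ^ 2 * g p ≤ 0) : ∀ᵐ p, g p = 0 := by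
  have hnn : ∀ᵐ p : E3, 0 ≤ ‖p‖ ^ 2 * g p := by
    filter_upwards [h0] with p hp
    positivity
  have h1 := (integral_eq_zero_iff_of_nonneg_ae hnn hi).mp
    (le_antisymm h (integral_nonneg_of_ae hnn))
  have hne : ∀ᵐ p : E3, p ≠ 0 := by
    simp [ae_iff]
  filter_upwards [h1, hne] with p h2 h3
  have : ‖p‖ ^ 2 ≠ 0 := by positivity
  exact (mul_eq_zero.mp h2).resolve_left this

/-- Minimizers at zero temperature satisfy the purity relation. -/
theorem IsMinimalAtDensity.purityRelation {V : E3 → ℝ} (hV : Admissible V) {γ α : E3 → ℝ} {ρ₀ : ℝ}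
    (h : IsMinimalAtDensity V (γ, α, ρ₀)) : PurityRelation γ α := by
  obtain ⟨⟨hmem, hρ₀⟩, hmin⟩ := h
  simp only at hρ₀ hmem
  have hP := isPair_of_mem hmem
  have hc := c3_pos
  have hkin0 : 0 ≤ ∫ p, ‖p‖ ^ 2 * γ p := by
    refine integral_nonneg_of_ae ?_
    filter_upwards [hP.nonneg] with p hp
    simp only [Pi.zero_apply]
    positivity
  have hQα := hP.pairInteraction_nonneg hV
  have hQγ := hP.self.pairInteraction_nonneg hV
  have hE := freeEnergyCan_zero_eq hV hP ρ₀
  -- This is, up to `c3`, the coefficient of `ρ₀` in the energy; its sign tells whether the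
  -- condensate gains from the other particles.
  rcases le_or_gt 0 ((∫ p, vhat V p * γ p) + ∫ p, vhat V p * α p) with hs | hs
  · -- condensing all particles lowers the energy
    have h0mem : ((fun _ => 0, fun _ => 0) : (E3 → ℝ) × (E3 → ℝ)) ∈ domainPair := by
      refine ⟨by simp, aestronglyMeasurable_const, ?_, ?_⟩ <;> simp
    have hd : density ((fun _ => 0, fun _ => 0, density (γ, α, ρ₀)) : Triple) =
        density (γ, α, ρ₀) := by
      simp [density, rhoGamma]
    have h1 := hmin (fun _ => 0, fun _ => 0, density (γ, α, ρ₀))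
      ⟨h0mem, add_nonneg hρ₀ (rhoGamma_nonneg hP.nonneg)⟩ hd
    rw [hE, freeEnergyCan_zero_eq hV (isPair_of_mem h0mem), hd] at h1
    simp only [mul_zero, integral_zero, pairInteraction, add_zero] at h1
    have h2 : 0 ≤ ρ₀ * (c3 * ((∫ p, vhat V p * γ p) + ∫ p, vhat V p * α p)) := by positivity
    have h3 : 0 ≤ 1 / 2 * (c3 ^ 2 * (pairInteraction V α + pairInteraction V γ)) := by positivity
    simp only [pairInteraction] at h3
    -- The terms in `V̂ 0` cancel because the densities agree, and the remaining interaction terms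
    -- are nonnegative.
    have h4 : c3 * (∫ p, ‖p‖ ^ 2 * γ p) ≤ 0 := by linarith
    have h5 : ∫ p, ‖p‖ ^ 2 * γ p ≤ 0 := nonpos_of_mul_nonpos_right h4 hc
    filter_upwards [ae_eq_zero_of_kinetic hP.nonneg (integrable_kinetic hmem.1) h5, hP.le]
      with p h6 h7
    rw [h6] at h7 ⊢
    nlinarith [sq_nonneg (α p)]
  · -- moving the excess of `γ` into the condensate lowers the energy
    -- The nonnegative root of `γ'(γ'+1) = α²`, hence the smallest momentum distribution admitting
    -- this `α`.
    set γ' : E3 → ℝ := fun p => -(1 / 2) + Real.sqrt (1 / 4 + α p ^ 2) with hγ'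
    have hγ'0 : ∀ p, 0 ≤ γ' p := fun p => by
      have : (1 / 2 : ℝ) ≤ Real.sqrt (1 / 4 + α p ^ 2) :=
        Real.le_sqrt_of_sq_le (by nlinarith [sq_nonneg (α p)])
      simp only [hγ']
      linarith
    have hrel : ∀ p, α p ^ 2 = γ' p * (γ' p + 1) := fun p => by
      have := Real.sq_sqrt (show 0 ≤ 1 / 4 + α p ^ 2 by positivity)
      simp only [hγ']
      linarith
    have hle : ∀ᵐ p, γ' p ≤ γ p := by
      filter_upwards [hP.nonneg, hP.le] with p h0 h1
      have := hrel p
      nlinarith [hγ'0 p]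
    have hγ'm : AEStronglyMeasurable γ' volume :=
      (Real.continuous_sqrt.comp_aestronglyMeasurable ((hP.measurable.pow 2).const_add _)).const_add _
    have hmem' : (γ', α) ∈ domainPair := by
      refine ⟨hmem.1.mono' (AEStronglyMeasurable.mul (Continuous.aestronglyMeasurable
        (by fun_prop)) hγ'm) ?_, hP.measurable, Filter.Eventually.of_forall hγ'0,
        Filter.Eventually.of_forall fun p => (hrel p).le⟩
      filter_upwards [hle] with p hp
      rw [Real.norm_of_nonneg (mul_nonneg (by positivity) (hγ'0 p))]
      exact mul_le_mul_of_nonneg_left hp (by positivity)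
    have hP' := isPair_of_mem hmem'
    have hδ : 0 ≤ rhoGamma γ - rhoGamma γ' := by
      rw [rhoGamma, rhoGamma, ← mul_sub]
      exact mul_nonneg hc.le (sub_nonneg.mpr (integral_mono_ae hP'.integrable hP.integrable hle))
    set δ := rhoGamma γ - rhoGamma γ' with hδdef
    have hd : density ((γ', α, ρ₀ + δ) : Triple) = density (γ, α, ρ₀) := by
      simp only [density, hδdef]
      ring
    have h1 := hmin (γ', α, ρ₀ + δ) ⟨hmem', add_nonneg hρ₀ hδ⟩ hd
    rw [hE, freeEnergyCan_zero_eq hV hP', hd] at h1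
    have hv : ∫ p, vhat V p * γ' p ≤ ∫ p, vhat V p * γ p := by
      refine integral_mono_ae (hP'.self.integrable_vhat_mul hV) (hP.self.integrable_vhat_mul hV) ?_
      filter_upwards [hle] with p hp
      exact mul_le_mul_of_nonneg_left hp (hV.vhat_nonneg p)
    have hQ : pairInteraction V γ' ≤ pairInteraction V γ := by
      refine integral_mono_ae (hP'.self.integrable_pair hV) (hP.self.integrable_pair hV) ?_
      filter_upwards [ae_prod_fst hle, ae_prod_snd hle] with z h2 h3
      exact mul_le_mul_of_nonneg_left (mul_le_mul h2 h3 (hγ'0 _) ((hγ'0 _).trans h2))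
        (hV.vhat_nonneg _)
    -- Lowering `γ` lowers the bracket, and since the original bracket is negative, enlarging the
    -- factor in front by `δ ≥ 0` lowers the product further.
    have h2 : (ρ₀ + δ) * (c3 * ((∫ p, vhat V p * γ' p) + ∫ p, vhat V p * α p)) ≤
        ρ₀ * (c3 * ((∫ p, vhat V p * γ p) + ∫ p, vhat V p * α p)) := by
      have e1 : c3 * ((∫ p, vhat V p * γ' p) + ∫ p, vhat V p * α p) ≤
          c3 * ((∫ p, vhat V p * γ p) + ∫ p, vhat V p * α p) :=
        mul_le_mul_of_nonneg_left (by linarith) hc.le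
      have e2 : c3 * ((∫ p, vhat V p * γ p) + ∫ p, vhat V p * α p) ≤ 0 :=
        mul_nonpos_of_nonneg_of_nonpos hc.le hs.le
      have e3 := mul_le_mul_of_nonneg_left e1 (add_nonneg hρ₀ hδ)
      nlinarith [mul_nonneg hδ (neg_nonneg.mpr e2)]
    have h3 : 1 / 2 * (c3 ^ 2 * (pairInteraction V α + pairInteraction V γ')) ≤
        1 / 2 * (c3 ^ 2 * (pairInteraction V α + pairInteraction V γ)) := by
      gcongr
    have h4 : c3 * ((∫ p, ‖p‖ ^ 2 * γ p) - ∫ p, ‖p‖ ^ 2 * γ' p) ≤ 0 := by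
      rw [mul_sub]
      linarith
    have h5 := nonpos_of_mul_nonpos_right h4 hc
    have i1 := integrable_kinetic hmem.1
    have i2 := integrable_kinetic hmem'.1
    rw [← integral_sub i1 i2] at h5
    have h6 : ∀ᵐ p, γ p - γ' p = 0 := by
      refine ae_eq_zero_of_kinetic (hle.mono fun p hp => sub_nonneg.mpr hp)
        ((i1.sub i2).congr (Filter.Eventually.of_forall fun p => ?_))
        (le_trans (le_of_eq (integral_congr_ae (Filter.Eventually.of_forall fun p => ?_))) h5)
      · simp only [Pi.sub_apply]
        ring
      · ring
    filter_upwards [h6] with p hp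
    rw [sub_eq_zero.mp hp]
    exact hrel p

/-! ### Evenness of minimizers by symmetrization -/

theorem midpoint_constraint {g h a b : ℝ} (hg : 0 ≤ g) (hh : 0 ≤ h) (ha : a ^ 2 ≤ g * (g + 1))
    (hb : b ^ 2 ≤ h * (h + 1)) : ((a + b) / 2) ^ 2 ≤ (g + h) / 2 * ((g + h) / 2 + 1) := by
  have := (le_abs_self _).trans (abs_mul_le_of_constraint hg hh ha hb)
  nlinarith

/-- The constraint set `α² ≤ γ(γ+1)` is strictly convex. -/
theorem eq_of_midpoint_extremal {g h a b : ℝ} (hg : 0 ≤ g) (hh : 0 ≤ h)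
    (ha : a ^ 2 ≤ g * (g + 1)) (hb : b ^ 2 ≤ h * (h + 1))
    (heq : ((a + b) / 2) ^ 2 = (g + h) / 2 * ((g + h) / 2 + 1)) : g = h ∧ a = b := by
  -- Equality at the midpoint forces `ab` up to its upper bound, so the slack `(g-h)²/4` in that
  -- bound has to vanish.
  have h1 : g * h + (g + h) / 2 ≤ a * b := by nlinarith
  have h2 : (g * h + (g + h) / 2) ^ 2 ≤ (a * b) ^ 2 :=
    pow_le_pow_left₀ (by positivity) h1 2
  have h3 := mul_le_mul ha hb (sq_nonneg b) (by positivity)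
  have h4 : (g - h) ^ 2 ≤ 0 := by nlinarith
  have h5 : g = h := by
    have := pow_eq_zero_iff (two_ne_zero) |>.mp (le_antisymm h4 (sq_nonneg _))
    linarith
  subst h5
  refine ⟨rfl, ?_⟩
  have h6 : (a - b) ^ 2 ≤ 0 := by nlinarith
  have := pow_eq_zero_iff (two_ne_zero) |>.mp (le_antisymm h6 (sq_nonneg _))
  linarith

theorem ae_comp_neg {P : E3 → Prop} (h : ∀ᵐ p, P p) : ∀ᵐ p : E3, P (-p) :=
  (Measure.measurePreserving_neg (volume : Measure E3)).quasiMeasurePreserving.ae h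

/-- The form is reflection invariant, so the parallelogram identity splits it into the even and odd
parts of `a`, and the odd part contributes a nonnegative amount. The functions `g`, `g'`, `g₁`, `g₂`
serve only to guarantee integrability. -/
theorem pairInteraction_symm_le {V : E3 → ℝ} (hV : Admissible V) {g g' g₁ g₂ a : E3 → ℝ}
    (h : IsPair g a) (h' : IsPair g' fun p => a (-p))
    (hs : IsPair g₁ fun p => (a p + a (-p)) / 2) (hd : IsPair g₂ fun p => (a p - a (-p)) / 2) :
    pairInteraction V (fun p => (a p + a (-p)) / 2) ≤ pairInteraction V a := by
  have hneg : pairInteraction V (fun p => a (-p)) = pairInteraction V a := by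
    have hn := Measure.measurePreserving_neg (volume : Measure E3)
    have : (volume : Measure (E3 × E3)).IsNegInvariant := ⟨(hn.prod hn).map_eq⟩
    unfold pairInteraction
    rw [← integral_neg_eq_self (fun z : E3 × E3 => vhat V (z.1 - z.2) * (a z.1 * a z.2))]
    refine integral_congr_ae (Filter.Eventually.of_forall fun z => ?_)
    simp only [Prod.fst_neg, Prod.snd_neg]
    rw [← vhat_neg hV]
    congr 2
    abel
  have hpar : pairInteraction V (fun p => (a p + a (-p)) / 2) +
      pairInteraction V (fun p => (a p - a (-p)) / 2) =
      (pairInteraction V a + pairInteraction V (fun p => a (-p))) / 2 := by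
    unfold pairInteraction
    rw [← integral_add (hs.integrable_pair hV) (hd.integrable_pair hV),
      ← integral_add (h.integrable_pair hV) (h'.integrable_pair hV), ← integral_div]
    refine integral_congr_ae (Filter.Eventually.of_forall fun z => ?_)
    ring
  have := hd.pairInteraction_nonneg hV
  linarith

/-- Minimizers at zero temperature are even. -/
theorem IsMinimalAtDensity.even {V : E3 → ℝ} (hV : Admissible V) {γ α : E3 → ℝ} {ρ₀ : ℝ}
    (h : IsMinimalAtDensity V (γ, α, ρ₀)) : IsEvenAE γ ∧ IsEvenAE α := by
  obtain ⟨⟨hmem, hρ₀⟩, hmin⟩ := h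
  simp only at hρ₀ hmem
  have hP := isPair_of_mem hmem
  have hPn : IsPair (fun p => γ (-p)) fun p => α (-p) :=
    ⟨hP.integrable.comp_neg, hP.measurable.comp_quasiMeasurePreserving
      (Measure.measurePreserving_neg (volume : Measure E3)).quasiMeasurePreserving,
      ae_comp_neg hP.nonneg, ae_comp_neg hP.le⟩
  set γs : E3 → ℝ := fun p => (γ p + γ (-p)) / 2 with hγs
  set αs : E3 → ℝ := fun p => (α p + α (-p)) / 2 with hαs
  have hwn : Integrable fun p : E3 => (1 + ‖p‖ ^ 2) * γ (-p) := by
    refine (Integrable.comp_neg hmem.1).congr (Filter.Eventually.of_forall fun p => ?_)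
    simp
  have hsmem : (γs, αs) ∈ domainPair := by
    refine ⟨?_, ?_, ?_, ?_⟩
    · refine ((hmem.1.add hwn).div_const 2).congr (Filter.Eventually.of_forall fun p => ?_)
      simp only [Pi.add_apply, hγs]
      ring
    · exact (hP.measurable.add hPn.measurable).mul_const (2⁻¹ : ℝ)
    · filter_upwards [hP.nonneg, hPn.nonneg] with p h1 h2
      simp only [hγs]
      linarith
    · filter_upwards [hP.nonneg, hPn.nonneg, hP.le, hPn.le] with p h1 h2 h3 h4
      exact midpoint_constraint h1 h2 h3 h4
  have hPs := isPair_of_mem hsmem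
  have hPd : IsPair γs fun p => (α p - α (-p)) / 2 := by
    refine ⟨hPs.integrable, (hP.measurable.sub hPn.measurable).mul_const (2⁻¹ : ℝ), hPs.nonneg, ?_⟩
    filter_upwards [hP.nonneg, hPn.nonneg, hP.le, hPn.le] with p h1 h2 h3 h4
    have := midpoint_constraint (b := -α (-p)) h1 h2 h3 (by simpa using h4)
    rw [← sub_eq_add_neg] at this
    exact this
  have hPdγ : IsPair γs fun p => (γ p - γ (-p)) / 2 := by
    refine ⟨hPs.integrable, (hP.integrable.1.sub hPn.integrable.1).mul_const (2⁻¹ : ℝ),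
      hPs.nonneg, ?_⟩
    filter_upwards [hP.nonneg, hPn.nonneg] with p h1 h2
    simp only [hγs]
    nlinarith
  have hQα : pairInteraction V αs ≤ pairInteraction V α := pairInteraction_symm_le hV hP hPn hPs hPd
  have hQγ : pairInteraction V γs ≤ pairInteraction V γ :=
    pairInteraction_symm_le hV hP.self hPn.self hPs.self hPdγ
  have hsym : ∀ (w f : E3 → ℝ), (∀ p, w (-p) = w p) → Integrable (fun p => w p * f p) →
      ∫ p, w p * ((f p + f (-p)) / 2) = ∫ p, w p * f p := by
    intro w f hw hi
    have hi' : Integrable fun p => w p * f (-p) := by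
      refine hi.comp_neg.congr (Filter.Eventually.of_forall fun p => ?_)
      simp only [hw]
    have e1 : ∫ p, w p * f (-p) = ∫ p, w p * f p := by
      rw [← integral_neg_eq_self (fun p => w p * f p)]
      simp only [hw]
    have e2 : ∫ p, w p * ((f p + f (-p)) / 2) =
        ((∫ p, w p * f p) + ∫ p, w p * f (-p)) / 2 := by
      rw [← integral_add hi hi', ← integral_div]
      refine integral_congr_ae (Filter.Eventually.of_forall fun p => ?_)
      ring
    rw [e2, e1]
    ring
  have hkin : ∫ p, ‖p‖ ^ 2 * γs p = ∫ p, ‖p‖ ^ 2 * γ p :=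
    hsym (fun p => ‖p‖ ^ 2) γ (fun p => by simp) (integrable_kinetic hmem.1)
  have hvγ : ∫ p, vhat V p * γs p = ∫ p, vhat V p * γ p :=
    hsym _ γ (vhat_neg hV) (hP.self.integrable_vhat_mul hV)
  have hvα : ∫ p, vhat V p * αs p = ∫ p, vhat V p * α p :=
    hsym _ α (vhat_neg hV) (hP.integrable_vhat_mul hV)
  have hρ : rhoGamma γs = rhoGamma γ := by
    have := hsym (fun _ => 1) γ (fun _ => rfl) (by simpa using hP.integrable)
    simp only [one_mul] at this
    rw [rhoGamma, rhoGamma, ← this]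
  have hd : density ((γs, αs, ρ₀) : Triple) = density (γ, α, ρ₀) := by
    simp only [density, hρ]
  have hE : freeEnergyCan V 0 (γs, αs, ρ₀) ≤ freeEnergyCan V 0 (γ, α, ρ₀) := by
    rw [freeEnergyCan_zero_eq hV hP, freeEnergyCan_zero_eq hV hPs, hkin, hvγ, hvα, hd]
    gcongr
  -- The average has the same density and no larger energy, so it is minimal too and must be
  -- saturated, although it is the midpoint of two admissible points.
  have hrel : PurityRelation γs αs := IsMinimalAtDensity.purityRelation hV (ρ₀ := ρ₀)
    ⟨⟨hsmem, hρ₀⟩, fun y hy hyd => hE.trans (hmin y hy (hyd.trans hd))⟩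
  have hall : ∀ᵐ p, γ p = γ (-p) ∧ α p = α (-p) := by
    filter_upwards [hP.nonneg, hPn.nonneg, hP.le, hPn.le, hrel] with p h1 h2 h3 h4 h5
    exact eq_of_midpoint_extremal h1 h2 h3 h4 h5
  exact ⟨hall.mono fun p hp => hp.1.symm, hall.mono fun p hp => hp.2.symm⟩

/-! ## Positive semidefinite kernels on arbitrary sets -/

section Kernels

variable {X : Type*}

/-- The sesquilinear form of a kernel on finitely supported functions. -/
def kernelForm (M : Matrix X X ℂ) (x y : X →₀ ℂ) : ℂ :=
  x.sum fun i xi => y.sum fun j yj => star xi * M i j * yj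

theorem kernelForm_add_left (M : Matrix X X ℂ) (x y z : X →₀ ℂ) :
    kernelForm M (x + y) z = kernelForm M x z + kernelForm M y z := by
  unfold kernelForm
  rw [Finsupp.sum_add_index']
  · simp
  · intro i a b
    simp [Finsupp.sum, add_mul, Finset.sum_add_distrib]

theorem kernelForm_add_right (M : Matrix X X ℂ) (x y z : X →₀ ℂ) :
    kernelForm M x (y + z) = kernelForm M x y + kernelForm M x z := by
  unfold kernelForm
  rw [← Finsupp.sum_add]
  refine Finsupp.sum_congr fun i _ => ?_
  rw [Finsupp.sum_add_index']
  · simp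
  · intro i a b
    ring

theorem kernelForm_smul_left (M : Matrix X X ℂ) (c : ℂ) (x y : X →₀ ℂ) :
    kernelForm M (c • x) y = star c * kernelForm M x y := by
  unfold kernelForm
  rw [Finsupp.sum_smul_index' (by simp)]
  simp only [Finsupp.sum, Finset.mul_sum, smul_eq_mul, star_mul']
  refine Finset.sum_congr rfl fun i _ => Finset.sum_congr rfl fun j _ => ?_
  ring

theorem kernelForm_smul_right (M : Matrix X X ℂ) (c : ℂ) (x y : X →₀ ℂ) :
    kernelForm M x (c • y) = c * kernelForm M x y := by
  unfold kernelForm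
  simp only [Finsupp.sum, Finset.mul_sum]
  refine Finset.sum_congr rfl fun i _ => ?_
  change (c • y).sum _ = _
  rw [Finsupp.sum_smul_index' (by simp)]
  refine Finset.sum_congr rfl fun j _ => ?_
  simp only [smul_eq_mul]
  ring

@[simp]
theorem kernelForm_single (M : Matrix X X ℂ) (i j : X) (c d : ℂ) :
    kernelForm M (Finsupp.single i c) (Finsupp.single j d) = star c * M i j * d := by
  simp [kernelForm]

theorem kernelForm_star (M : Matrix X X ℂ) (hM : M.IsHermitian) (x y : X →₀ ℂ) :
    star (kernelForm M x y) = kernelForm M y x := by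
  unfold kernelForm Finsupp.sum
  simp only [star_sum]
  rw [Finset.sum_comm]
  refine Finset.sum_congr rfl fun i _ => Finset.sum_congr rfl fun j _ => ?_
  rw [star_mul', star_mul', star_star, hM.apply]
  ring

/-- Polarization: the vectors `e_i + e_j` and `e_i + I e_j` separately fix the imaginary and real
parts of `M i j` against those of `M j i`. -/
theorem isHermitian_of_kernelForm_im {M : Matrix X X ℂ}
    (h : ∀ x : X →₀ ℂ, (kernelForm M x x).im = 0) : M.IsHermitian := by
  have hd : ∀ i, (M i i).im = 0 := fun i => by simpa using h (Finsupp.single i 1)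
  refine Matrix.IsHermitian.ext fun i j => ?_
  have h1 := h (Finsupp.single i 1 + Finsupp.single j 1)
  have h2 := h (Finsupp.single i 1 + Finsupp.single j Complex.I)
  simp [kernelForm_add_left, kernelForm_add_right, hd] at h1 h2
  apply Complex.ext
  · simp
    linarith
  · simp
    linarith

theorem posSemidef_of_kernelForm {M : Matrix X X ℂ}
    (h : ∀ x : X →₀ ℂ, 0 ≤ (kernelForm M x x).re ∧ (kernelForm M x x).im = 0) :
    M.PosSemidef :=
  ⟨isHermitian_of_kernelForm_im fun x => (h x).2, fun x =>
    Complex.nonneg_iff.mpr ⟨(h x).1, (h x).2.symm⟩⟩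

theorem kernelForm_nonneg {M : Matrix X X ℂ} (hM : M.PosSemidef) (x : X →₀ ℂ) :
    0 ≤ kernelForm M x x := hM.2 x

/-- The Cauchy-Schwarz inequality for a positive semidefinite kernel. -/
theorem kernelForm_cauchySchwarz {M : Matrix X X ℂ} (hM : M.PosSemidef) (x y : X →₀ ℂ) :
    ‖kernelForm M x y‖ ^ 2 ≤ (kernelForm M x x).re * (kernelForm M y y).re := by
  let _ : PreInnerProductSpace.Core ℂ (X →₀ ℂ) :=
    { inner := kernelForm M
      conj_inner_symm := fun x y => kernelForm_star M hM.1 y x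
      re_inner_nonneg := fun x => (Complex.nonneg_iff.mp (kernelForm_nonneg hM x)).1
      add_left := kernelForm_add_left M
      smul_left := fun x y c => kernelForm_smul_left M c x y }
  have h := InnerProductSpace.Core.inner_mul_inner_self_le (𝕜 := ℂ) x y
  have h2 : ‖kernelForm M y x‖ = ‖kernelForm M x y‖ := by
    rw [← kernelForm_star M hM.1, norm_star]
  change ‖kernelForm M x y‖ * ‖kernelForm M y x‖ ≤ _ at h
  rw [h2] at h
  rw [pow_two]
  exact h

/-- A pointwise limit of positive semidefinite kernels is positive semidefinite. -/
theorem posSemidef_of_tendsto {F : ℕ → Matrix X X ℂ} {M : Matrix X X ℂ}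
    (hF : ∀ n, (F n).PosSemidef)
    (h : ∀ i j, Filter.Tendsto (fun n => F n i j) Filter.atTop (𝓝 (M i j))) : M.PosSemidef := by
  have hlim : ∀ x : X →₀ ℂ, Filter.Tendsto (fun n => kernelForm (F n) x x) Filter.atTop
      (𝓝 (kernelForm M x x)) := fun x =>
    tendsto_finsetSum _ fun i _ => tendsto_finsetSum _ fun j _ =>
      ((h i j).const_mul _).mul_const _
  have hn : ∀ x : X →₀ ℂ, 0 ≤ kernelForm M x x := fun x =>
    ge_of_tendsto' (hlim x) fun n => kernelForm_nonneg (hF n) x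
  exact posSemidef_of_kernelForm fun x =>
    ⟨(Complex.nonneg_iff.mp (hn x)).1, (Complex.nonneg_iff.mp (hn x)).2.symm⟩

theorem posSemidef_conj_mul (d : X → ℂ) :
    (Matrix.of fun i j => star (d i) * d j : Matrix X X ℂ).PosSemidef := by
  refine posSemidef_of_kernelForm fun x => ?_
  have : kernelForm (Matrix.of fun i j => star (d i) * d j) x x =
      star (x.sum fun i xi => xi * d i) * (x.sum fun i xi => xi * d i) := by
    unfold kernelForm Finsupp.sum
    rw [star_sum, Finset.sum_mul_sum]
    refine Finset.sum_congr rfl fun i _ => Finset.sum_congr rfl fun j _ => ?_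
    simp only [Matrix.of_apply, star_mul']
    ring
  rw [this]
  have h := Complex.nonneg_iff.mp (star_mul_self_nonneg (x.sum fun i xi => xi * d i))
  exact ⟨h.1, h.2.symm⟩

/-- The entrywise exponential of a positive semidefinite kernel is positive semidefinite. -/
theorem posSemidef_exp {M : Matrix X X ℂ} (hM : M.PosSemidef) :
    (Matrix.of fun i j => Complex.exp (M i j) : Matrix X X ℂ).PosSemidef := by
  have hone : (Matrix.of fun _ _ => 1 : Matrix X X ℂ).PosSemidef := by
    simpa using posSemidef_conj_mul (fun _ : X => (1 : ℂ))
  -- By the Schur product theorem entrywise powers stay positive semidefinite; the exponential is a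
  -- limit of their nonnegative combinations.
  have hpow : ∀ n : ℕ, (Matrix.of fun i j => M i j ^ n : Matrix X X ℂ).PosSemidef := by
    intro n
    induction n with
    | zero => simpa using hone
    | succ n ih =>
      have h : (Matrix.of fun i j => M i j ^ (n + 1) : Matrix X X ℂ) =
          Matrix.hadamard (Matrix.of fun i j => M i j ^ n) M := by
        ext i j
        simp [pow_succ]
      rw [h]
      exact ih.hadamard hM
  refine posSemidef_of_tendsto
    (F := fun n => ∑ k ∈ Finset.range n, ((k.factorial : ℝ)⁻¹) • Matrix.of fun i j => M i j ^ k)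
    (fun n => ?_) (fun i j => ?_)
  · exact Matrix.posSemidef_sum _ fun k _ => (hpow k).smul (by positivity)
  · have h := (NormedSpace.expSeries_div_hasSum_exp (𝔸 := ℂ) (M i j)).tendsto_sum_nat
    rw [← Complex.exp_eq_exp_ℂ] at h
    refine h.congr fun n => ?_
    simp only [Matrix.sum_apply, Matrix.smul_apply, Matrix.of_apply, Complex.real_smul]
    refine Finset.sum_congr rfl fun k _ => ?_
    push_cast
    ring

end Kernels

/-! ## States of the Weyl algebra and kernels -/

theorem symp_neg_left (f g : 𝓢(E3, ℂ)) : symp (-f) g = -symp f g := by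
  simp [symp, integral_neg]

/-- The kernel `ω(W(f)* W(g))`. -/
def stateKernel (ω : Weyl →ₗ[ℂ] ℂ) : Matrix 𝓢(E3, ℂ) 𝓢(E3, ℂ) ℂ :=
  Matrix.of fun f g => Complex.exp (Complex.I * ((symp f g : ℝ) : ℂ) / 2) * ω (weylOp (g - f))

/-- Because `W(f)* W(g) = e^{i Im⟨f,g⟩/2} W(g-f)`, positivity on the algebra becomes positivity of a
kernel on test functions. -/
theorem apply_weylStar_mul (ω : Weyl →ₗ[ℂ] ℂ) (a b : Weyl) :
    ω (weylMul (weylStar a) b) = kernelForm (stateKernel ω) a b := by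
  have h1 : weylMul (weylStar a) b = a.sum fun f c => b.sum fun g d => Finsupp.single (-f + g)
      ((starRingEnd ℂ) c * d * Complex.exp (-(Complex.I * ((symp (-f) g : ℝ) : ℂ) / 2))) := by
    unfold weylMul weylStar
    rw [Finsupp.sum_sum_index]
    · refine Finsupp.sum_congr fun f _ => ?_
      rw [Finsupp.sum_single_index]
      simp
    · simp
    · intro f c d
      rw [← Finsupp.sum_add]
      refine Finsupp.sum_congr fun g _ => ?_
      rw [← Finsupp.single_add]
      ring_nf
  rw [h1]
  unfold kernelForm Finsupp.sum
  rw [map_sum]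
  refine Finset.sum_congr rfl fun f _ => ?_
  rw [map_sum]
  refine Finset.sum_congr rfl fun g _ => ?_
  have h2 : ∀ (h : 𝓢(E3, ℂ)) (z : ℂ), ω (Finsupp.single h z) = z * ω (weylOp h) := fun h z => by
    rw [weylOp, ← smul_eq_mul, ← map_smul, Finsupp.smul_single, smul_eq_mul, mul_one]
  simp only [h2, stateKernel, Matrix.of_apply, symp_neg_left, neg_add_eq_sub,
    Complex.star_def]
  push_cast
  ring_nf

theorem mem_states_iff (ω : Weyl →ₗ[ℂ] ℂ) :
    ω ∈ states ↔ ω (weylOp 0) = 1 ∧ (stateKernel ω).PosSemidef := by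
  simp only [states, Set.mem_ofPred_eq, apply_weylStar_mul]
  refine and_congr_right fun _ => ⟨posSemidef_of_kernelForm, fun h a => ?_⟩
  have := Complex.nonneg_iff.mp (kernelForm_nonneg h a)
  exact ⟨this.1, this.2.symm⟩

/-! ## Gaussian functionals with an abstract covariance -/

/-- A covariance: a positive semidefinite real-bilinear kernel whose imaginary part is the
symplectic form. -/
structure IsCovariance (K : Matrix 𝓢(E3, ℂ) 𝓢(E3, ℂ) ℂ) : Prop where
  posSemidef : K.PosSemidef
  add_right : ∀ f g h, K f (g + h) = K f g + K f h
  smul_right : ∀ (r : ℝ) f g, K f (r • g) = r * K f g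
  im_eq : ∀ f g, (K f g).im = symp f g

/-- The expectation of `W(f)` in the Gaussian functional with covariance `K` and mean `L`. -/
def gaussianAmp (K : Matrix 𝓢(E3, ℂ) 𝓢(E3, ℂ) ℂ) (L : 𝓢(E3, ℂ) →+ ℝ) (f : 𝓢(E3, ℂ)) : ℂ :=
  Complex.exp (((-((K f f).re / 4) : ℝ) : ℂ) + Complex.I * ((L f : ℝ) : ℂ))

/-- The Gaussian functional with covariance `K` and mean `L`. -/
def gaussianFunctional (K : Matrix 𝓢(E3, ℂ) 𝓢(E3, ℂ) ℂ) (L : 𝓢(E3, ℂ) →+ ℝ) : Weyl →ₗ[ℂ] ℂ :=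
  Finsupp.linearCombination ℂ (gaussianAmp K L)

theorem symp_zero_left (g : 𝓢(E3, ℂ)) : symp 0 g = 0 := by simp [symp]

theorem linearMap_single (ω : Weyl →ₗ[ℂ] ℂ) (h : 𝓢(E3, ℂ)) (z : ℂ) :
    ω (Finsupp.single h z) = z * ω (weylOp h) := by
  rw [weylOp, ← smul_eq_mul, ← map_smul, Finsupp.smul_single, smul_eq_mul, mul_one]

theorem weyl_ext {ω φ : Weyl →ₗ[ℂ] ℂ} (h : ∀ f, ω (weylOp f) = φ (weylOp f)) : ω = φ := by
  refine Finsupp.lhom_ext fun f c => ?_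
  rw [linearMap_single, linearMap_single, h]

@[simp]
theorem gaussianFunctional_weylOp (K : Matrix 𝓢(E3, ℂ) 𝓢(E3, ℂ) ℂ) (L : 𝓢(E3, ℂ) →+ ℝ)
    (f : 𝓢(E3, ℂ)) : gaussianFunctional K L (weylOp f) = gaussianAmp K L f := by
  simp [gaussianFunctional, weylOp]

theorem gaussianAmp_ne_zero (K : Matrix 𝓢(E3, ℂ) 𝓢(E3, ℂ) ℂ) (L : 𝓢(E3, ℂ) →+ ℝ)
    (f : 𝓢(E3, ℂ)) : gaussianAmp K L f ≠ 0 := Complex.exp_ne_zero _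

namespace IsCovariance

variable {K : Matrix 𝓢(E3, ℂ) 𝓢(E3, ℂ) ℂ}

theorem conj_symm (hK : IsCovariance K) (f g : 𝓢(E3, ℂ)) : star (K f g) = K g f := hK.posSemidef.1.apply g f

theorem add_left (hK : IsCovariance K) (f g h : 𝓢(E3, ℂ)) : K (f + g) h = K f h + K g h := by
  rw [← hK.conj_symm, hK.add_right, star_add, hK.conj_symm, hK.conj_symm]

theorem smul_left (hK : IsCovariance K) (r : ℝ) (f g : 𝓢(E3, ℂ)) : K (r • f) g = r * K f g := by
  rw [← hK.conj_symm, hK.smul_right, star_mul', hK.conj_symm]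
  simp

theorem neg_right (hK : IsCovariance K) (f g : 𝓢(E3, ℂ)) : K f (-g) = -K f g := by
  have := hK.smul_right (-1) f g
  simpa using this

theorem neg_left (hK : IsCovariance K) (f g : 𝓢(E3, ℂ)) : K (-f) g = -K f g := by
  have := hK.smul_left (-1) f g
  simpa using this

theorem zero_right (hK : IsCovariance K) (f : 𝓢(E3, ℂ)) : K f 0 = 0 := by
  have := hK.smul_right 0 f 0
  simpa using this

theorem diag_eq (hK : IsCovariance K) (f : 𝓢(E3, ℂ)) : K f f = ((K f f).re : ℂ) := by
  have := hK.conj_symm f f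
  exact (Complex.conj_eq_iff_re.mp this).symm

theorem re_diag_nonneg (hK : IsCovariance K) (f : 𝓢(E3, ℂ)) : 0 ≤ (K f f).re := by
  have h := kernelForm_nonneg hK.posSemidef (Finsupp.single f 1)
  simp only [kernelForm_single, star_one, one_mul, mul_one] at h
  exact (Complex.nonneg_iff.mp h).1

/-- Polarizing `-K(g-f, g-f)/4` leaves the symmetric part of `K(f,g)/2`, and the Weyl phase supplies
its antisymmetric part since `Im K` is the symplectic form. Up to a rank-one factor the kernel is
thus the exponential of `K/2`. -/
theorem stateKernel_gaussian (hK : IsCovariance K) (L : 𝓢(E3, ℂ) →+ ℝ) (f g : 𝓢(E3, ℂ)) :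
    stateKernel (gaussianFunctional K L) f g =
      star (gaussianAmp K L f) * gaussianAmp K L g * Complex.exp ((2⁻¹ : ℝ) * K f g) := by
  have h1 : ((K (g - f) (g - f)).re : ℂ) = K g g - K g f - K f g + K f f := by
    rw [← hK.diag_eq, sub_eq_add_neg, hK.add_left, hK.add_right, hK.add_right, hK.neg_left,
      hK.neg_left, hK.neg_right, hK.neg_right]
    ring
  have h2 : Complex.I * ((symp f g : ℝ) : ℂ) = (K f g - K g f) / 2 := by
    rw [← hK.im_eq, ← hK.conj_symm f g]
    apply Complex.ext <;> simp
  have h3 : (starRingEnd ℂ) (K f f) = K f f := hK.conj_symm f f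
  simp only [stateKernel, Matrix.of_apply, gaussianFunctional_weylOp, gaussianAmp,
    Complex.star_def, ← Complex.exp_conj, ← Complex.exp_add, h2]
  congr 1
  simp only [Complex.ofReal_neg, Complex.ofReal_div, h1, map_sub, map_add, map_neg, map_mul,
    Complex.conj_ofReal, Complex.conj_I, ← hK.diag_eq, map_div₀, h3]
  push_cast
  ring

theorem gaussianAmp_zero (hK : IsCovariance K) (L : 𝓢(E3, ℂ) →+ ℝ) : gaussianAmp K L 0 = 1 := by
  simp [gaussianAmp, hK.zero_right]

theorem gaussianAmp_neg (hK : IsCovariance K) (L : 𝓢(E3, ℂ) →+ ℝ) (f : 𝓢(E3, ℂ)) :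
    gaussianAmp K L (-f) = star (gaussianAmp K L f) := by
  simp only [gaussianAmp, Complex.star_def, ← Complex.exp_conj, hK.neg_left, hK.neg_right,
    neg_neg, map_neg, map_add, map_mul, Complex.conj_I, Complex.conj_ofReal]
  congr 1
  push_cast
  ring

theorem posSemidef_exp_half (hK : K.PosSemidef) :
    (Matrix.of fun f g => Complex.exp ((2⁻¹ : ℝ) * K f g) : Matrix _ _ ℂ).PosSemidef := by
  have := posSemidef_exp (hK.smul (a := (2⁻¹ : ℝ)) (by norm_num))
  simpa using this

/-- A Gaussian functional with a positive semidefinite covariance is a state. -/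
theorem gaussianFunctional_mem_states (hK : IsCovariance K) (L : 𝓢(E3, ℂ) →+ ℝ) :
    gaussianFunctional K L ∈ states := by
  rw [mem_states_iff]
  refine ⟨by simp [hK.gaussianAmp_zero], ?_⟩
  have h : stateKernel (gaussianFunctional K L) =
      Matrix.hadamard (Matrix.of fun i j => star (gaussianAmp K L i) * gaussianAmp K L j)
        (Matrix.of fun f g => Complex.exp ((2⁻¹ : ℝ) * K f g)) := by
    ext f g
    rw [hK.stateKernel_gaussian]
    rfl
  rw [h]
  exact (posSemidef_conj_mul (gaussianAmp K L)).hadamard (posSemidef_exp_half hK.posSemidef)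

end IsCovariance

/-! ### Cauchy–Schwarz and convex combinations for states -/

theorem kernelForm_stateKernel_zero (φ : Weyl →ₗ[ℂ] ℂ) (x : Weyl) :
    kernelForm (stateKernel φ) (Finsupp.single 0 1) x = φ x := by
  induction x using Finsupp.induction_linear with
  | zero => simp [kernelForm]
  | add x y hx hy => rw [kernelForm_add_right, hx, hy, map_add]
  | single g c =>
    rw [kernelForm_single, linearMap_single]
    simp [stateKernel, symp_zero_left, mul_comm]

/-- Cauchy–Schwarz against the unit `W(0)`, on which `φ` equals `1`. -/
theorem norm_sq_le_of_mem_states {φ : Weyl →ₗ[ℂ] ℂ} (hφ : φ ∈ states) (x : Weyl) :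
    ‖φ x‖ ^ 2 ≤ (kernelForm (stateKernel φ) x x).re := by
  rw [mem_states_iff] at hφ
  have h := kernelForm_cauchySchwarz hφ.2 (Finsupp.single 0 1) x
  rw [kernelForm_stateKernel_zero, kernelForm_stateKernel_zero] at h
  have h1 : φ (Finsupp.single 0 1) = 1 := hφ.1
  simpa [h1] using h

theorem apply_weylOp_neg {φ : Weyl →ₗ[ℂ] ℂ} (hφ : φ ∈ states) (f : 𝓢(E3, ℂ)) :
    φ (weylOp (-f)) = star (φ (weylOp f)) := by
  rw [mem_states_iff] at hφ
  have h := hφ.2.1.apply f 0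
  have h0 : symp f 0 = 0 := by simp [symp]
  simp only [stateKernel, Matrix.of_apply, symp_zero_left, h0] at h
  simpa using h.symm

theorem kernelForm_stateKernel_combination (a b : ℝ) (φ₁ φ₂ : Weyl →ₗ[ℂ] ℂ) (x : Weyl) :
    kernelForm (stateKernel (a • φ₁ + b • φ₂)) x x =
      a * kernelForm (stateKernel φ₁) x x + b * kernelForm (stateKernel φ₂) x x := by
  simp only [← apply_weylStar_mul]
  simp

/-! ### Rigidity of states dominated by a Gaussian state -/

namespace IsCovariance

variable {K : Matrix 𝓢(E3, ℂ) 𝓢(E3, ℂ) ℂ}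

/-- The normalized Weyl operator `W(f) / ω(W(f))`. -/
def _root_.BogoliubovGas.normalizedWeyl (K : Matrix 𝓢(E3, ℂ) 𝓢(E3, ℂ) ℂ) (L : 𝓢(E3, ℂ) →+ ℝ)
    (f : 𝓢(E3, ℂ)) : Weyl := Finsupp.single f (gaussianAmp K L f)⁻¹

theorem kernelForm_normalizedWeyl (hK : IsCovariance K) (L : 𝓢(E3, ℂ) →+ ℝ) (f g : 𝓢(E3, ℂ)) :
    kernelForm (stateKernel (gaussianFunctional K L)) (normalizedWeyl K L f)
      (normalizedWeyl K L g) = Complex.exp ((2⁻¹ : ℝ) * K f g) := by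
  have h1 := gaussianAmp_ne_zero K L f
  have h2 := gaussianAmp_ne_zero K L g
  have h3 : star (gaussianAmp K L f) ≠ 0 := star_ne_zero.mpr h1
  rw [normalizedWeyl, normalizedWeyl, kernelForm_single, hK.stateKernel_gaussian, star_inv₀]
  field_simp

/-- The first-order antiholomorphic increment of the normalized Weyl operators at `g`. -/
def _root_.BogoliubovGas.weylIncrement (K : Matrix 𝓢(E3, ℂ) 𝓢(E3, ℂ) ℂ) (L : 𝓢(E3, ℂ) →+ ℝ)
    (g h k : 𝓢(E3, ℂ)) (s : ℝ) : Weyl :=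
  normalizedWeyl K L (g + s • h) + Complex.I • normalizedWeyl K L (g + s • k)
    + (-(1 + Complex.I)) • normalizedWeyl K L g

/-- The expansion is grouped so that each summand is visibly of order `s²`: it contains either one
factor `exp (s² ·) - 1` or a product of two first-order factors. -/
theorem kernelForm_weylIncrement (hK : IsCovariance K) (L : 𝓢(E3, ℂ) →+ ℝ)
    (g h k : 𝓢(E3, ℂ)) (s : ℝ) :
    kernelForm (stateKernel (gaussianFunctional K L)) (weylIncrement K L g h k s)
      (weylIncrement K L g h k s) =
    Complex.exp (K g g / 2) *
      (Complex.exp (s * (K h g / 2)) * Complex.exp (s * (K g h / 2)) *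
          (Complex.exp (s ^ 2 * (K h h / 2)) - 1)
        + Complex.I * (Complex.exp (s * (K h g / 2)) * Complex.exp (s * (K g k / 2))) *
          (Complex.exp (s ^ 2 * (K h k / 2)) - 1)
        - Complex.I * (Complex.exp (s * (K k g / 2)) * Complex.exp (s * (K g h / 2))) *
          (Complex.exp (s ^ 2 * (K k h / 2)) - 1)
        + Complex.exp (s * (K k g / 2)) * Complex.exp (s * (K g k / 2)) *
          (Complex.exp (s ^ 2 * (K k k / 2)) - 1)
        + ((Complex.exp (s * (K h g / 2)) - 1) - Complex.I * (Complex.exp (s * (K k g / 2)) - 1)) *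
          ((Complex.exp (s * (K g h / 2)) - 1)
            + Complex.I * (Complex.exp (s * (K g k / 2)) - 1))) := by
  have key : ∀ x y : 𝓢(E3, ℂ), Complex.exp ((2⁻¹ : ℝ) * K (g + s • x) (g + s • y)) =
      Complex.exp (K g g / 2) * Complex.exp (s * (K x g / 2)) * Complex.exp (s * (K g y / 2)) *
        Complex.exp (s ^ 2 * (K x y / 2)) := by
    intro x y
    rw [← Complex.exp_add, ← Complex.exp_add, ← Complex.exp_add]
    congr 1
    rw [hK.add_left, hK.add_right, hK.add_right, hK.smul_left, hK.smul_left, hK.smul_right,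
      hK.smul_right]
    push_cast
    ring
  have key0 : ∀ y : 𝓢(E3, ℂ), Complex.exp ((2⁻¹ : ℝ) * K g (g + s • y)) =
      Complex.exp (K g g / 2) * Complex.exp (s * (K g y / 2)) := by
    intro y
    rw [← Complex.exp_add]
    congr 1
    rw [hK.add_right, hK.smul_right]
    push_cast
    ring
  have key1 : ∀ x : 𝓢(E3, ℂ), Complex.exp ((2⁻¹ : ℝ) * K (g + s • x) g) =
      Complex.exp (K g g / 2) * Complex.exp (s * (K x g / 2)) := by
    intro x
    rw [← Complex.exp_add]
    congr 1
    rw [hK.add_left, hK.smul_left]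
    push_cast
    ring
  have key2 : Complex.exp ((2⁻¹ : ℝ) * K g g) = Complex.exp (K g g / 2) := by
    congr 1
    push_cast
    ring
  simp only [weylIncrement, kernelForm_add_left, kernelForm_add_right, kernelForm_smul_left,
    kernelForm_smul_right, hK.kernelForm_normalizedWeyl, key, key0, key1, key2, Complex.star_def,
    map_neg, map_add, map_one, Complex.conj_I]
  linear_combination (Complex.exp (K g g / 2) * (Complex.exp (s * (K k g / 2)) *
    Complex.exp (s * (K g k / 2)) * (1 - Complex.exp (s ^ 2 * (K k k / 2))))) * Complex.I_sq

theorem tendsto_exp_sub_one_div (w : ℂ) :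
    Filter.Tendsto (fun s : ℝ => (Complex.exp (s * w) - 1) / s) (𝓝[≠] 0) (𝓝 w) := by
  have h : HasDerivAt (fun s : ℝ => Complex.exp (s * w)) w 0 := by
    have h1 : HasDerivAt (fun s : ℝ => (s : ℂ) * w) w 0 := by
      simpa using (Complex.ofRealCLM.hasDerivAt (x := (0 : ℝ))).mul_const w
    simpa using h1.cexp
  rw [hasDerivAt_iff_tendsto_slope] at h
  refine h.congr' (Filter.Eventually.of_forall fun s => ?_)
  simp [slope_def_module, div_eq_inv_mul]

theorem tendsto_exp_sq_sub_one_div (w : ℂ) :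
    Filter.Tendsto (fun s : ℝ => (Complex.exp (s ^ 2 * w) - 1) / s ^ 2) (𝓝[≠] 0) (𝓝 w) := by
  have h : Filter.Tendsto (fun s : ℝ => s ^ 2) (𝓝[≠] 0) (𝓝[≠] 0) := by
    refine tendsto_nhdsWithin_iff.mpr ⟨?_, ?_⟩
    · have : Filter.Tendsto (fun s : ℝ => s ^ 2) (𝓝 0) (𝓝 (0 ^ 2)) := (continuous_pow 2).tendsto 0
      exact (by simpa using this : Filter.Tendsto _ _ (𝓝 (0 : ℝ))).mono_left nhdsWithin_le_nhds
    · filter_upwards [self_mem_nhdsWithin] with s hs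
      exact pow_ne_zero 2 hs
  have := (tendsto_exp_sub_one_div w).comp h
  refine this.congr fun s => ?_
  simp

theorem tendsto_exp_one (w : ℂ) :
    Filter.Tendsto (fun s : ℝ => Complex.exp (s * w)) (𝓝[≠] 0) (𝓝 1) := by
  have : Filter.Tendsto (fun s : ℝ => Complex.exp (s * w)) (𝓝 0) (𝓝 (Complex.exp ((0 : ℝ) * w))) :=
    Continuous.tendsto (by fun_prop) 0
  simpa using this.mono_left nhdsWithin_le_nhds

/-- With `ξ = h + i k` and `K` extended sesquilinearly, the limit is `e^{K(g,g)/2} (K(ξ,ξ)/2 +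
K(ξ,g) K(g,ξ)/4)`. -/
theorem tendsto_kernelForm_weylIncrement (hK : IsCovariance K) (L : 𝓢(E3, ℂ) →+ ℝ)
    (g h k : 𝓢(E3, ℂ)) :
    Filter.Tendsto (fun s : ℝ => kernelForm (stateKernel (gaussianFunctional K L))
      (weylIncrement K L g h k s) (weylIncrement K L g h k s) / s ^ 2) (𝓝[≠] 0)
      (𝓝 (Complex.exp (K g g / 2) *
        ((K h h + Complex.I * K h k - Complex.I * K k h + K k k) / 2
          + (K h g - Complex.I * K k g) * (K g h + Complex.I * K g k) / 4))) := by
  have e := tendsto_exp_one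
  have d := tendsto_exp_sub_one_div
  have q := tendsto_exp_sq_sub_one_div
  have main := ((((((e (K h g / 2)).mul (e (K g h / 2))).mul (q (K h h / 2))).add
    ((((e (K h g / 2)).mul (e (K g k / 2))).const_mul Complex.I).mul (q (K h k / 2)))).sub
    ((((e (K k g / 2)).mul (e (K g h / 2))).const_mul Complex.I).mul (q (K k h / 2)))).add
    (((e (K k g / 2)).mul (e (K g k / 2))).mul (q (K k k / 2)))).add
    (((d (K h g / 2)).sub ((d (K k g / 2)).const_mul Complex.I)).mul
      ((d (K g h / 2)).add ((d (K g k / 2)).const_mul Complex.I)))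
  have main2 := main.const_mul (Complex.exp (K g g / 2))
  refine (main2.congr' ?_).trans (le_of_eq ?_)
  · filter_upwards [self_mem_nhdsWithin] with s hs
    have hs' : (s : ℂ) ≠ 0 := by exact_mod_cast hs
    rw [hK.kernelForm_weylIncrement]
    field_simp
  · congr 1
    ring

theorem kernel_defect_eq (hK : IsCovariance K) (h k : 𝓢(E3, ℂ)) :
    K h h + Complex.I * K h k - Complex.I * K k h + K k k =
      (((K h h).re + (K k k).re - 2 * symp h k : ℝ) : ℂ) := by
  rw [← hK.conj_symm h k, ← hK.im_eq, hK.diag_eq h, hK.diag_eq k]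
  apply Complex.ext <;> simp
  ring

/-- Cauchy–Schwarz for `K` applied to `g` and `ξ = h + i k`. It makes the whole second-order
coefficient of the increment controlled by the defect `K(ξ,ξ)` alone. -/
theorem kernel_cross_bound (hK : IsCovariance K) (g h k : 𝓢(E3, ℂ)) :
    ((K h g - Complex.I * K k g) * (K g h + Complex.I * K g k)).re ≤
      (K g g).re * ((K h h).re + (K k k).re - 2 * symp h k) := by
  have h1 := kernelForm_cauchySchwarz hK.posSemidef (Finsupp.single g 1)
    (Finsupp.single h 1 + Complex.I • Finsupp.single k 1)
  simp only [kernelForm_add_left, kernelForm_add_right, kernelForm_smul_left,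
    kernelForm_smul_right, kernelForm_single, star_one, one_mul, mul_one, Complex.star_def,
    Complex.conj_I] at h1
  have h2 : K h h + -Complex.I * K k h + Complex.I * (K h k + -Complex.I * K k k) =
      (((K h h).re + (K k k).re - 2 * symp h k : ℝ) : ℂ) := by
    rw [← hK.kernel_defect_eq]
    linear_combination (-(K k k)) * Complex.I_sq
  rw [h2, Complex.ofReal_re] at h1
  refine le_trans (le_of_eq ?_) h1
  rw [← hK.conj_symm g h, ← hK.conj_symm g k, ← Complex.normSq_eq_norm_sq]
  simp [Complex.normSq_apply]
  ring

/-- The ratio `φ(W(f)) / ω(W(f))`. -/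
def _root_.BogoliubovGas.weylRatio (K : Matrix 𝓢(E3, ℂ) 𝓢(E3, ℂ) ℂ) (L : 𝓢(E3, ℂ) →+ ℝ)
    (φ : Weyl →ₗ[ℂ] ℂ) (f : 𝓢(E3, ℂ)) : ℂ := φ (normalizedWeyl K L f)

/-- Both states are Hermitian. This symmetry exchanges the holomorphic and antiholomorphic
increments. -/
theorem weylRatio_neg (hK : IsCovariance K) (L : 𝓢(E3, ℂ) →+ ℝ) {φ : Weyl →ₗ[ℂ] ℂ}
    (hφ : φ ∈ states) (f : 𝓢(E3, ℂ)) : weylRatio K L φ (-f) = star (weylRatio K L φ f) := by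
  rw [weylRatio, weylRatio, normalizedWeyl, normalizedWeyl, linearMap_single, linearMap_single,
    apply_weylOp_neg hφ, hK.gaussianAmp_neg, star_mul', star_inv₀]

/-- A state dominated by a Gaussian state is almost holomorphic in almost holomorphic directions. -/
theorem eventually_increment_le (hK : IsCovariance K) (L : 𝓢(E3, ℂ) →+ ℝ) {φ : Weyl →ₗ[ℂ] ℂ}
    (hφ : φ ∈ states) {a : ℝ} (ha : 0 < a)
    (hdom : ∀ x, a * (kernelForm (stateKernel φ) x x).re ≤
      (kernelForm (stateKernel (gaussianFunctional K L)) x x).re)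
    (g h k : 𝓢(E3, ℂ)) {ε : ℝ} (hk : (K h h).re + (K k k).re - 2 * symp h k < ε) :
    ∀ᶠ s : ℝ in 𝓝[≠] 0, ‖(weylRatio K L φ (g + s • h) - weylRatio K L φ g)
        + Complex.I * (weylRatio K L φ (g + s • k) - weylRatio K L φ g)‖ ^ 2 ≤
      a⁻¹ * (Real.exp ((K g g).re / 2) * (1 + (K g g).re)) * ε * s ^ 2 := by
  set D := (K h h).re + (K k k).re - 2 * symp h k with hD
  set κ := (K g g).re with hκ
  have hκ0 : 0 ≤ κ := hK.re_diag_nonneg g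
  have hD0 : 0 ≤ D := by
    have h1 := kernelForm_nonneg hK.posSemidef
      (Finsupp.single h 1 + Complex.I • Finsupp.single k 1)
    simp only [kernelForm_add_left, kernelForm_add_right, kernelForm_smul_left,
      kernelForm_smul_right, kernelForm_single, star_one, one_mul, mul_one, Complex.star_def,
      Complex.conj_I] at h1
    have h2 : K h h + -Complex.I * K k h + Complex.I * (K h k + -Complex.I * K k k) =
        ((D : ℝ) : ℂ) := by
      rw [hD, ← hK.kernel_defect_eq]
      linear_combination (-(K k k)) * Complex.I_sq
    rw [h2] at h1
    exact_mod_cast h1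
  have hlim := Complex.continuous_re.continuousAt.tendsto.comp
    (hK.tendsto_kernelForm_weylIncrement L g h k)
  -- The limit is at most `e^{κ/2} (D/2 + κD/4)`; the wasteful factor `1 + κ` and `D < ε` give the
  -- strict inequality needed for small `s`.
  have hlt : (Complex.exp (K g g / 2) *
        ((K h h + Complex.I * K h k - Complex.I * K k h + K k k) / 2
          + (K h g - Complex.I * K k g) * (K g h + Complex.I * K g k) / 4)).re <
      Real.exp (κ / 2) * (1 + κ) * ε := by
    have h1 : Complex.exp (K g g / 2) = ((Real.exp (κ / 2) : ℝ) : ℂ) := by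
      rw [hK.diag_eq g]
      push_cast
      rfl
    rw [h1, Complex.re_ofReal_mul, hK.kernel_defect_eq, mul_assoc]
    refine mul_lt_mul_of_pos_left ?_ (Real.exp_pos _)
    have h3 := hK.kernel_cross_bound g h k
    have h4 : ((((D : ℝ) : ℂ)) / 2
        + (K h g - Complex.I * K k g) * (K g h + Complex.I * K g k) / 4).re =
        D / 2 + ((K h g - Complex.I * K k g) * (K g h + Complex.I * K g k)).re / 4 := by
      rw [Complex.add_re, Complex.div_ofNat_re, Complex.div_ofNat_re, Complex.ofReal_re]
    rw [← hD, h4]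
    nlinarith [mul_nonneg hκ0 hD0, mul_nonneg hκ0 (hk.le.trans' hD0)]
  filter_upwards [hlim.eventually_lt_const hlt, self_mem_nhdsWithin] with s hs hs0
  have hs2 : 0 < s ^ 2 := by
    have : s ≠ 0 := hs0
    positivity
  have h5 : (kernelForm (stateKernel (gaussianFunctional K L))
      (weylIncrement K L g h k s) (weylIncrement K L g h k s)).re <
      Real.exp (κ / 2) * (1 + κ) * ε * s ^ 2 := by
    have h6 : ((kernelForm (stateKernel (gaussianFunctional K L))
      (weylIncrement K L g h k s) (weylIncrement K L g h k s)) / (s : ℂ) ^ 2).re =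
      (kernelForm (stateKernel (gaussianFunctional K L))
      (weylIncrement K L g h k s) (weylIncrement K L g h k s)).re / s ^ 2 := by
      rw [← Complex.ofReal_pow, Complex.div_ofReal_re]
    simp only [Function.comp] at hs
    rwa [h6, div_lt_iff₀ hs2] at hs
  have h7 := norm_sq_le_of_mem_states hφ (weylIncrement K L g h k s)
  have h8 := hdom (weylIncrement K L g h k s)
  have h9 : φ (weylIncrement K L g h k s) =
      (weylRatio K L φ (g + s • h) - weylRatio K L φ g)
        + Complex.I * (weylRatio K L φ (g + s • k) - weylRatio K L φ g) := by
    simp only [weylIncrement, map_add, map_smul, smul_eq_mul, weylRatio]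
    ring
  rw [h9] at h7
  rw [mul_assoc, mul_assoc, inv_mul_eq_div, le_div_iff₀ ha]
  nlinarith

/-- The increment bound at `(g, h, k)` controls `u + i v`, and at `(-g, -h, -k)`, after conjugation,
it controls `u - i v`. The parallelogram law then bounds `u` alone. -/
theorem eventually_weylRatio_sub_le (hK : IsCovariance K) (L : 𝓢(E3, ℂ) →+ ℝ)
    {φ : Weyl →ₗ[ℂ] ℂ} (hφ : φ ∈ states) {a : ℝ} (ha : 0 < a)
    (hdom : ∀ x, a * (kernelForm (stateKernel φ) x x).re ≤
      (kernelForm (stateKernel (gaussianFunctional K L)) x x).re)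
    (g h k : 𝓢(E3, ℂ)) {ε : ℝ} (hk : (K h h).re + (K k k).re - 2 * symp h k < ε) :
    ∀ᶠ s : ℝ in 𝓝[≠] 0, ‖weylRatio K L φ (g + s • h) - weylRatio K L φ g‖ ^ 2 ≤
      a⁻¹ * (Real.exp ((K g g).re / 2) * (1 + (K g g).re)) * ε * s ^ 2 := by
  have hk' : (K (-h) (-h)).re + (K (-k) (-k)).re - 2 * symp (-h) (-k) < ε := by
    rw [← hK.im_eq]
    simpa [hK.neg_left, hK.neg_right, hK.im_eq] using hk
  have hg' : K (-g) (-g) = K g g := by rw [hK.neg_left, hK.neg_right, neg_neg]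
  have h2 := hK.eventually_increment_le L hφ ha hdom (-g) (-h) (-k) hk'
  rw [hg'] at h2
  filter_upwards [hK.eventually_increment_le L hφ ha hdom g h k hk, h2] with s h1 h2
  have e1 : ∀ x : 𝓢(E3, ℂ), -g + s • -x = -(g + s • x) := fun x => by
    rw [smul_neg]; abel
  rw [e1, e1, hK.weylRatio_neg L hφ, hK.weylRatio_neg L hφ, hK.weylRatio_neg L hφ] at h2
  set u := weylRatio K L φ (g + s • h) - weylRatio K L φ g
  set v := weylRatio K L φ (g + s • k) - weylRatio K L φ g
  have h3 : ‖u - Complex.I * v‖ ^ 2 ≤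
      a⁻¹ * (Real.exp ((K g g).re / 2) * (1 + (K g g).re)) * ε * s ^ 2 := by
    refine le_trans (le_of_eq ?_) h2
    rw [← norm_star (u - Complex.I * v)]
    congr 2
    simp only [u, v, star_sub, star_mul', Complex.star_def, Complex.conj_I]
    ring
  have h4 := parallelogram_law_with_norm ℝ u (Complex.I * v)
  nlinarith [sq_nonneg ‖Complex.I * v‖]

/-- If the covariance is pure, then so is the Gaussian state. -/
theorem isPureState_gaussianFunctional (hK : IsCovariance K) (L : 𝓢(E3, ℂ) →+ ℝ)
    (hpure : ∀ (h : 𝓢(E3, ℂ)) (ε : ℝ), 0 < ε →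
      ∃ k, (K h h).re + (K k k).re - 2 * symp h k < ε) :
    IsPureState (gaussianFunctional K L) := by
  refine ⟨hK.gaussianFunctional_mem_states L, ?_⟩
  rintro φ hφ ψ hψ ⟨a, b, ha, hb, -, hab⟩
  have hdom : ∀ x, a * (kernelForm (stateKernel φ) x x).re ≤
      (kernelForm (stateKernel (gaussianFunctional K L)) x x).re := by
    intro x
    rw [← hab, kernelForm_stateKernel_combination]
    have h1 := (Complex.nonneg_iff.mp (kernelForm_nonneg ((mem_states_iff ψ).mp hψ).2 x)).1
    simp only [Complex.add_re, Complex.re_ofReal_mul]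
    nlinarith [mul_nonneg hb.le h1]
  have hsmall : ∀ (g h : 𝓢(E3, ℂ)) (η : ℝ), 0 < η → ∀ᶠ s : ℝ in 𝓝[≠] 0,
      ‖weylRatio K L φ (g + s • h) - weylRatio K L φ g‖ ≤ η * ‖s‖ := by
    intro g h η hη
    set C := a⁻¹ * (Real.exp ((K g g).re / 2) * (1 + (K g g).re)) with hC
    have hC0 : 0 < C := by
      have := hK.re_diag_nonneg g
      positivity
    -- This choice of defect cancels the constant `C`, so the squared increment is at most `η² s²`.
    obtain ⟨k, hk⟩ := hpure h (η ^ 2 / C) (by positivity)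
    filter_upwards [hK.eventually_weylRatio_sub_le L hφ ha hdom g h k hk] with s hs
    rw [← hC, mul_div_cancel₀ _ hC0.ne', ← mul_pow, ← sq_abs (η * s)] at hs
    have := abs_le_of_sq_le_sq' hs (abs_nonneg _)
    rw [Real.norm_eq_abs]
    calc _ ≤ _ := this.2
      _ = _ := by rw [abs_mul, abs_of_pos hη]
  have hderiv : ∀ (h : 𝓢(E3, ℂ)) (τ : ℝ),
      HasDerivAt (fun τ : ℝ => weylRatio K L φ (τ • h)) 0 τ := by
    intro h τ
    rw [hasDerivAt_iff_isLittleO_nhds_zero, Asymptotics.isLittleO_iff]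
    intro c hc
    have h1 := eventually_nhdsWithin_iff.mp (hsmall (τ • h) h c hc)
    filter_upwards [h1] with s hs
    by_cases hs0 : s = 0
    · simp [hs0]
    · have := hs hs0
      rw [add_smul, smul_zero, sub_zero]
      exact this
  refine weyl_ext fun f => ?_
  -- The ratio is constant along the ray through `f`, and at the origin it equals `1`.
  have hconst := is_const_of_deriv_eq_zero (f := fun τ : ℝ => weylRatio K L φ (τ • f))
    (fun τ => (hderiv f τ).differentiableAt) (fun τ => (hderiv f τ).deriv) 1 0
  simp only [one_smul, zero_smul, weylRatio, normalizedWeyl, hK.gaussianAmp_zero, inv_one] at hconst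
  rw [linearMap_single, linearMap_single, hφ.1, one_mul] at hconst
  rw [gaussianFunctional_weylOp]
  have := gaussianAmp_ne_zero K L f
  field_simp at hconst
  exact hconst

end IsCovariance

/-! ### Mixtures of displaced Gaussian states -/

/-- The covariance obtained by removing a classical Gaussian fluctuation of the field. -/
def reducedKernel (K : Matrix 𝓢(E3, ℂ) 𝓢(E3, ℂ) ℂ) (l : 𝓢(E3, ℂ) →ₗ[ℝ] ℝ) (c : ℝ) :
    Matrix 𝓢(E3, ℂ) 𝓢(E3, ℂ) ℂ :=
  Matrix.of fun f g => K f g - ((c * l f * l g : ℝ) : ℂ)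

/-- The mixture with weight `w` of Gaussian functionals with displaced means. -/
def displacedMixture (K : Matrix 𝓢(E3, ℂ) 𝓢(E3, ℂ) ℂ) (L : 𝓢(E3, ℂ) →+ ℝ)
    (l : 𝓢(E3, ℂ) →ₗ[ℝ] ℝ) (μ : Measure ℝ) (w : ℝ → ℝ) : Weyl →ₗ[ℂ] ℂ :=
  Finsupp.linearCombination ℂ fun f =>
    ∫ x, ((w x : ℝ) : ℂ) * gaussianAmp K (L + (x • l).toAddMonoidHom) f ∂μ

theorem gaussianAmp_displaced (K : Matrix 𝓢(E3, ℂ) 𝓢(E3, ℂ) ℂ) (L : 𝓢(E3, ℂ) →+ ℝ)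
    (l : 𝓢(E3, ℂ) →ₗ[ℝ] ℝ) (x : ℝ) (f : 𝓢(E3, ℂ)) :
    gaussianAmp K (L + (x • l).toAddMonoidHom) f =
      gaussianAmp K L f * Complex.exp (l f * x * Complex.I) := by
  rw [gaussianAmp, gaussianAmp, ← Complex.exp_add]
  congr 1
  simp
  ring

theorem norm_gaussianAmp_displaced (K : Matrix 𝓢(E3, ℂ) 𝓢(E3, ℂ) ℂ) (L : 𝓢(E3, ℂ) →+ ℝ)
    (l : 𝓢(E3, ℂ) →ₗ[ℝ] ℝ) (x : ℝ) (f : 𝓢(E3, ℂ)) :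
    ‖gaussianAmp K (L + (x • l).toAddMonoidHom) f‖ = ‖gaussianAmp K L f‖ := by
  rw [gaussianAmp_displaced, norm_mul, ← Complex.ofReal_mul, Complex.norm_exp_ofReal_mul_I, mul_one]

theorem integrable_weight_mul_amp (K : Matrix 𝓢(E3, ℂ) 𝓢(E3, ℂ) ℂ) (L : 𝓢(E3, ℂ) →+ ℝ)
    (l : 𝓢(E3, ℂ) →ₗ[ℝ] ℝ) (μ : Measure ℝ) [IsProbabilityMeasure μ] {w : ℝ → ℝ}
    (hw : Continuous w) {B : ℝ} (hB : ∀ x, |w x| ≤ B) (f : 𝓢(E3, ℂ)) :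
    Integrable (fun x => ((w x : ℝ) : ℂ) * gaussianAmp K (L + (x • l).toAddMonoidHom) f) μ := by
  refine Integrable.of_bound (C := B * ‖gaussianAmp K L f‖) ?_ (Filter.Eventually.of_forall
    fun x => ?_)
  · simp only [gaussianAmp_displaced]
    exact Continuous.aestronglyMeasurable (by fun_prop)
  · rw [norm_mul, norm_gaussianAmp_displaced, Complex.norm_real, Real.norm_eq_abs]
    exact mul_le_mul_of_nonneg_right (hB x) (norm_nonneg _)

@[simp]
theorem displacedMixture_weylOp (K : Matrix 𝓢(E3, ℂ) 𝓢(E3, ℂ) ℂ) (L : 𝓢(E3, ℂ) →+ ℝ)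
    (l : 𝓢(E3, ℂ) →ₗ[ℝ] ℝ) (μ : Measure ℝ) (w : ℝ → ℝ) (f : 𝓢(E3, ℂ)) :
    displacedMixture K L l μ w (weylOp f) =
      ∫ x, ((w x : ℝ) : ℂ) * gaussianAmp K (L + (x • l).toAddMonoidHom) f ∂μ := by
  simp [displacedMixture, weylOp]

/-- The kernel form of the mixture is the `w`-weighted integral of nonnegative kernel forms of
displaced Gaussian states. -/
theorem displacedMixture_mem_states {K : Matrix 𝓢(E3, ℂ) 𝓢(E3, ℂ) ℂ} (hK : IsCovariance K)
    (L : 𝓢(E3, ℂ) →+ ℝ) (l : 𝓢(E3, ℂ) →ₗ[ℝ] ℝ) (μ : Measure ℝ) [IsProbabilityMeasure μ]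
    {w : ℝ → ℝ} (hw : Continuous w) {B : ℝ} (hB : ∀ x, |w x| ≤ B) (hw0 : ∀ x, 0 ≤ w x)
    (hw1 : ∫ x, w x ∂μ = 1) : displacedMixture K L l μ w ∈ states := by
  rw [mem_states_iff]
  refine ⟨?_, posSemidef_of_kernelForm fun a => ?_⟩
  · simp only [displacedMixture_weylOp, hK.gaussianAmp_zero, mul_one]
    rw [integral_complex_ofReal, hw1, Complex.ofReal_one]
  · have hint : ∀ f g : 𝓢(E3, ℂ), Integrable (fun x => ((w x : ℝ) : ℂ) * (star (a f) *
        stateKernel (gaussianFunctional K (L + (x • l).toAddMonoidHom)) f g * a g)) μ := by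
      intro f g
      have h := (integrable_weight_mul_amp K L l μ hw hB (g - f)).const_mul
        (star (a f) * Complex.exp (Complex.I * ((symp f g : ℝ) : ℂ) / 2) * a g)
      refine h.congr (Filter.Eventually.of_forall fun x => ?_)
      simp only [stateKernel, Matrix.of_apply, gaussianFunctional_weylOp]
      ring
    have key : kernelForm (stateKernel (displacedMixture K L l μ w)) a a =
        ∫ x, ((w x * (kernelForm (stateKernel (gaussianFunctional K
          (L + (x • l).toAddMonoidHom))) a a).re : ℝ) : ℂ) ∂μ := by
      have h1 : ∀ x, ((w x * (kernelForm (stateKernel (gaussianFunctional K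
          (L + (x • l).toAddMonoidHom))) a a).re : ℝ) : ℂ) =
          ∑ f ∈ a.support, ∑ g ∈ a.support, ((w x : ℝ) : ℂ) * (star (a f) *
            stateKernel (gaussianFunctional K (L + (x • l).toAddMonoidHom)) f g * a g) := by
        intro x
        have h2 := Complex.nonneg_iff.mp (kernelForm_nonneg ((mem_states_iff _).mp
          (hK.gaussianFunctional_mem_states (L + (x • l).toAddMonoidHom))).2 a)
        have h3 : (((kernelForm (stateKernel (gaussianFunctional K
          (L + (x • l).toAddMonoidHom))) a a).re : ℝ) : ℂ) = kernelForm (stateKernel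
            (gaussianFunctional K (L + (x • l).toAddMonoidHom))) a a :=
          Complex.ext rfl (by simpa using h2.2)
        rw [Complex.ofReal_mul, h3]
        simp only [kernelForm, Finsupp.sum, Finset.mul_sum]
      simp only [h1]
      rw [integral_finsetSum _ fun f _ => integrable_finsetSum _ fun g _ => hint f g]
      unfold kernelForm Finsupp.sum
      refine Finset.sum_congr rfl fun f _ => ?_
      rw [integral_finsetSum _ fun g _ => hint f g]
      refine Finset.sum_congr rfl fun g _ => ?_
      simp only [stateKernel, Matrix.of_apply, gaussianFunctional_weylOp, displacedMixture_weylOp]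
      rw [mul_comm (star (a f)), mul_assoc, mul_assoc, mul_comm _ (star (a f) * a g), ← mul_assoc,
        ← integral_const_mul]
      refine integral_congr_ae (Filter.Eventually.of_forall fun x => ?_)
      ring
    rw [key, integral_complex_ofReal]
    refine ⟨?_, Complex.ofReal_im _⟩
    rw [Complex.ofReal_re]
    refine integral_nonneg fun x => mul_nonneg (hw0 x) ?_
    exact (Complex.nonneg_iff.mp (kernelForm_nonneg ((mem_states_iff _).mp
      (hK.gaussianFunctional_mem_states (L + (x • l).toAddMonoidHom))).2 a)).1

/-- The subtracted kernel is real and bilinear, so the symplectic imaginary part is untouched and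
only positivity has to be assumed. -/
theorem IsCovariance.reduced {K : Matrix 𝓢(E3, ℂ) 𝓢(E3, ℂ) ℂ} (hK : IsCovariance K)
    {l : 𝓢(E3, ℂ) →ₗ[ℝ] ℝ} {c : ℝ} (hpos : (reducedKernel K l c).PosSemidef) :
    IsCovariance (reducedKernel K l c) where
  posSemidef := hpos
  add_right f g h := by
    simp only [reducedKernel, Matrix.of_apply, hK.add_right, map_add]
    push_cast
    ring
  smul_right r f g := by
    simp only [reducedKernel, Matrix.of_apply, hK.smul_right, map_smul, smul_eq_mul]
    push_cast
    ring
  im_eq f g := by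
    simp only [reducedKernel, Matrix.of_apply, Complex.sub_im, Complex.ofReal_im, sub_zero]
    exact hK.im_eq f g

/-- A Gaussian state whose covariance dominates a classical fluctuation is not pure. -/
theorem not_isPureState_gaussianFunctional {K : Matrix 𝓢(E3, ℂ) 𝓢(E3, ℂ) ℂ}
    (hK : IsCovariance K) (L : 𝓢(E3, ℂ) →+ ℝ) (l : 𝓢(E3, ℂ) →ₗ[ℝ] ℝ) {c : ℝ} (hc : 0 < c)
    (hpos : (reducedKernel K l c).PosSemidef) {f₀ : 𝓢(E3, ℂ)} (hf₀ : l f₀ ≠ 0) :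
    ¬ IsPureState (gaussianFunctional K L) := by
  intro hpure
  have hK' := hK.reduced hpos
  -- With variance `c/2` the characteristic function is `e^{-ct²/4}`, exactly the factor that the
  -- subtraction removed from the amplitude `e^{-K(f,f)/4}` at `t = l f`.
  set v : NNReal := (c / 2).toNNReal with hv
  set μ : Measure ℝ := ProbabilityTheory.gaussianReal 0 v with hμ
  have hchar : ∀ t : ℝ, ∫ x, Complex.exp (t * x * Complex.I) ∂μ =
      Complex.exp (-((c * t ^ 2 / 4 : ℝ) : ℂ)) := by
    intro t
    rw [← charFun_apply_real, hμ, ProbabilityTheory.charFun_gaussianReal]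
    rw [hv, Real.coe_toNNReal _ (by positivity)]
    congr 1
    push_cast
    ring
  have hexp_int : ∀ (t : ℝ), Integrable (fun x : ℝ => Complex.exp (t * x * Complex.I)) μ := by
    intro t
    refine Integrable.of_bound (C := 1) (Continuous.aestronglyMeasurable (by fun_prop))
      (Filter.Eventually.of_forall fun x => ?_)
    rw [← Complex.ofReal_mul, Complex.norm_exp_ofReal_mul_I]
  have hsin_int : Integrable (fun x : ℝ => Real.sin x) μ :=
    Integrable.of_bound (C := 1) (Continuous.aestronglyMeasurable (by fun_prop))
      (Filter.Eventually.of_forall fun x => by simpa using Real.abs_sin_le_one x)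
  have hsin : ∀ x : ℝ, (Real.sin x : ℂ) = (Complex.exp ((1 : ℝ) * x * Complex.I) -
      Complex.exp ((-1 : ℝ) * x * Complex.I)) * (-Complex.I / 2) := by
    intro x
    rw [Complex.ofReal_sin, Complex.sin]
    push_cast
    ring_nf
  have hsin_zero : ∫ x, Real.sin x ∂μ = 0 := by
    have : ((∫ x, Real.sin x ∂μ : ℝ) : ℂ) = 0 := by
      rw [← integral_complex_ofReal]
      simp only [hsin]
      rw [integral_mul_const, integral_sub (hexp_int _) (hexp_int _), hchar, hchar]
      simp
    exact_mod_cast this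
  -- The weight `1 + r sin x` is nonnegative for `|r| ≤ 1` and keeps total mass `1` because the sine
  -- averages to zero.
  have hstate : ∀ r : ℝ, |r| ≤ 1 → displacedMixture (reducedKernel K l c) L l μ
      (fun x => 1 + r * Real.sin x) ∈ states := by
    intro r hr
    have habs : ∀ x, |r * Real.sin x| ≤ 1 := fun x => by
      rw [abs_mul]
      exact mul_le_one₀ hr (abs_nonneg _) (Real.abs_sin_le_one x)
    refine displacedMixture_mem_states hK' L l μ (by fun_prop) (B := 2) (fun x => ?_)
      (fun x => ?_) ?_
    · have h1 := abs_le.mp (habs x)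
      exact abs_le.mpr ⟨by linarith, by linarith⟩
    · linarith [(abs_le.mp (habs x)).1]
    · rw [integral_add (integrable_const _) (hsin_int.const_mul _), integral_const_mul, hsin_zero]
      simp
  have hamp : ∀ (f : 𝓢(E3, ℂ)), gaussianAmp K L f =
      gaussianAmp (reducedKernel K l c) L f * ∫ x, Complex.exp (l f * x * Complex.I) ∂μ := by
    intro f
    rw [hchar, gaussianAmp, gaussianAmp, ← Complex.exp_add]
    congr 1
    simp [reducedKernel]
    ring
  have hsplit : ∀ (r : ℝ) (f : 𝓢(E3, ℂ)), displacedMixture (reducedKernel K l c) L l μ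
      (fun x => 1 + r * Real.sin x) (weylOp f) = gaussianAmp K L f +
        r * (gaussianAmp (reducedKernel K l c) L f *
          ∫ x, (Real.sin x : ℂ) * Complex.exp (l f * x * Complex.I) ∂μ) := by
    intro r f
    rw [displacedMixture_weylOp, hamp, ← integral_const_mul, ← integral_const_mul,
      ← integral_const_mul, ← integral_add]
    · refine integral_congr_ae (Filter.Eventually.of_forall fun x => ?_)
      simp only [gaussianAmp_displaced]
      push_cast
      ring
    · exact (hexp_int _).const_mul _
    · refine Integrable.const_mul (Integrable.const_mul ?_ _) _
      refine Integrable.of_bound (C := 1) (Continuous.aestronglyMeasurable (by fun_prop))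
        (Filter.Eventually.of_forall fun x => ?_)
      rw [norm_mul, ← Complex.ofReal_mul, Complex.norm_exp_ofReal_mul_I, mul_one,
        Complex.norm_real]
      exact Real.abs_sin_le_one x
  have hmid : gaussianFunctional K L ∈ openSegment ℝ
      (displacedMixture (reducedKernel K l c) L l μ (fun x => 1 + 1 * Real.sin x))
      (displacedMixture (reducedKernel K l c) L l μ (fun x => 1 + (-1) * Real.sin x)) := by
    refine ⟨1 / 2, 1 / 2, by norm_num, by norm_num, by norm_num, weyl_ext fun f => ?_⟩
    rw [LinearMap.add_apply, LinearMap.smul_apply, LinearMap.smul_apply, hsplit, hsplit,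
      gaussianFunctional_weylOp]
    simp only [Complex.real_smul]
    push_cast
    ring
  have heq := hpure.2 (hstate 1 (by simp)) (hstate (-1) (by simp)) hmid
  -- Rescaling `f₀` so that `l` takes the value `1` turns the perturbation into a multiple of `∫ sin
  -- x e^{ix} dμ = (-i/2)(e^{-c} - 1)`, which is nonzero.
  have hval : displacedMixture (reducedKernel K l c) L l μ (fun x => 1 + 1 * Real.sin x)
      (weylOp ((l f₀)⁻¹ • f₀)) = gaussianFunctional K L (weylOp ((l f₀)⁻¹ • f₀)) := by rw [heq]
  rw [hsplit, gaussianFunctional_weylOp, map_smul, smul_eq_mul, inv_mul_cancel₀ hf₀,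
    Complex.ofReal_one, one_mul, add_eq_left, mul_eq_zero] at hval
  replace hval := hval.resolve_left (gaussianAmp_ne_zero _ _ _)
  simp only [one_mul] at hval
  have hsq : ∀ x : ℝ, (Real.sin x : ℂ) * Complex.exp (x * Complex.I) =
      (Complex.exp ((2 : ℝ) * x * Complex.I) - Complex.exp ((0 : ℝ) * x * Complex.I)) *
        (-Complex.I / 2) := by
    intro x
    rw [hsin, mul_right_comm, sub_mul, ← Complex.exp_add, ← Complex.exp_add]
    congr 3 <;> · push_cast; ring
  simp only [hsq] at hval
  rw [integral_mul_const, integral_sub (hexp_int _) (hexp_int _), hchar, hchar] at hval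
  have hne : Complex.exp (-((c * 2 ^ 2 / 4 : ℝ) : ℂ)) ≠ 1 := by
    rw [← Complex.ofReal_neg, ← Complex.ofReal_exp]
    have : Real.exp (-(c * 2 ^ 2 / 4)) < 1 := by
      rw [← Real.exp_zero]
      exact Real.exp_lt_exp.mpr (by linarith)
    exact_mod_cast this.ne
  have hI : (-Complex.I / 2) ≠ 0 := by simp
  rcases mul_eq_zero.mp hval with h | h
  · apply hne
    rw [sub_eq_zero] at h
    rw [h]
    simp
  · exact hI h

/-! ## The covariance of a quasi-free functional -/

/-- Continuous, bounded and integrable functions. -/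
structure IsTame (F : E3 → ℂ) : Prop where
  continuous : Continuous F
  integrable : Integrable F
  bounded : ∃ C, ∀ p, ‖F p‖ ≤ C

theorem isTame_schwartz (f : 𝓢(E3, ℂ)) : IsTame f where
  continuous := f.continuous
  integrable := f.integrable
  bounded := by
    obtain ⟨C, -, hC⟩ := f.decay 0 0
    exact ⟨C, fun p => by simpa using hC p⟩

theorem IsTame.conj {F : E3 → ℂ} (hF : IsTame F) : IsTame fun p => (starRingEnd ℂ) (F p) where
  continuous := Complex.continuous_conj.comp hF.continuous
  integrable := by
    refine hF.integrable.norm.mono' (Complex.continuous_conj.comp hF.continuous).aestronglyMeasurable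
      (Filter.Eventually.of_forall fun p => ?_)
    simp
  bounded := by simpa using hF.bounded

theorem IsTame.reflect {F : E3 → ℂ} (hF : IsTame F) : IsTame fun p => F (-p) where
  continuous := hF.continuous.comp continuous_neg
  integrable := hF.integrable.comp_neg
  bounded := hF.bounded.imp fun _ h p => h (-p)

theorem IsTame.mul {F G : E3 → ℂ} (hF : IsTame F) (hG : IsTame G) : IsTame fun p => F p * G p where
  continuous := hF.continuous.mul hG.continuous
  integrable := by
    obtain ⟨C, hC⟩ := hF.bounded
    exact hG.integrable.bdd_mul hF.continuous.aestronglyMeasurable (Filter.Eventually.of_forall hC)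
  bounded := by
    obtain ⟨C, hC⟩ := hF.bounded
    obtain ⟨D, hD⟩ := hG.bounded
    exact ⟨C * D, fun p => by
      rw [norm_mul]
      exact mul_le_mul (hC p) (hD p) (norm_nonneg _) ((norm_nonneg _).trans (hC p))⟩

theorem IsTame.const_mul {F : E3 → ℂ} (hF : IsTame F) (c : ℂ) : IsTame fun p => c * F p where
  continuous := by have := hF.continuous; fun_prop
  integrable := hF.integrable.const_mul c
  bounded := by
    obtain ⟨C, hC⟩ := hF.bounded
    exact ⟨‖c‖ * C, fun p => by
      rw [norm_mul]
      exact mul_le_mul_of_nonneg_left (hC p) (norm_nonneg _)⟩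

theorem IsTame.add {F G : E3 → ℂ} (hF : IsTame F) (hG : IsTame G) : IsTame fun p => F p + G p where
  continuous := hF.continuous.add hG.continuous
  integrable := hF.integrable.add hG.integrable
  bounded := by
    obtain ⟨C, hC⟩ := hF.bounded
    obtain ⟨D, hD⟩ := hG.bounded
    exact ⟨C + D, fun p => (norm_add_le _ _).trans (add_le_add (hC p) (hD p))⟩

theorem isTame_zero : IsTame fun _ => 0 where
  continuous := continuous_const
  integrable := integrable_zero _ _ _
  bounded := ⟨0, fun _ => by simp⟩

theorem isTame_sum {ι : Type*} (s : Finset ι) {F : ι → E3 → ℂ} (hF : ∀ i ∈ s, IsTame (F i)) :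
    IsTame fun p => ∑ i ∈ s, F i p := by
  classical
  induction s using Finset.induction_on with
  | empty => simpa using isTame_zero
  | insert i s hi ih =>
    simp only [Finset.sum_insert hi]
    exact (hF i (Finset.mem_insert_self i s)).add
      (ih fun j hj => hF j (Finset.mem_insert_of_mem hj))

/-- Pairs `(γ, α)` in `𝒟'` that are even. -/
structure IsEvenPair (γ α : E3 → ℝ) : Prop where
  integrable : Integrable γ
  measurable : AEStronglyMeasurable α volume
  nonneg : ∀ᵐ p, 0 ≤ γ p
  le : ∀ᵐ p, α p ^ 2 ≤ γ p * (γ p + 1)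
  even_left : IsEvenAE γ
  even_right : IsEvenAE α

theorem integrable_weight_mul {γ w : E3 → ℝ} (hγ : Integrable γ)
    (hw : AEStronglyMeasurable w volume) (hle : ∀ᵐ p, |w p| ≤ 1 + 2 * γ p)
    {F : E3 → ℂ} (hF : IsTame F) : Integrable fun p => (w p : ℂ) * F p := by
  obtain ⟨C, hC⟩ := hF.bounded
  have hC0 : 0 ≤ C := (norm_nonneg _).trans (hC 0)
  refine (hF.integrable.norm.add ((hγ.norm.const_mul (2 * C)))).mono'
    ((Complex.continuous_ofReal.comp_aestronglyMeasurable hw).mul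
      hF.continuous.aestronglyMeasurable) ?_
  filter_upwards [hle] with p hp
  rw [norm_mul, Complex.norm_real, Real.norm_eq_abs]
  have h1 := mul_le_mul_of_nonneg_right hp (norm_nonneg (F p))
  have h2 := mul_le_mul (le_abs_self (γ p)) (hC p) (norm_nonneg (F p)) (abs_nonneg _)
  simp only [Pi.add_apply, Real.norm_eq_abs]
  nlinarith

namespace IsEvenPair

variable {γ α : E3 → ℝ}

theorem integrable_left (h : IsEvenPair γ α) {F : E3 → ℂ} (hF : IsTame F) :
    Integrable fun p => (γ p : ℂ) * F p := by
  refine integrable_weight_mul h.integrable h.integrable.1 ?_ hF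
  filter_upwards [h.nonneg] with p hp
  rw [abs_of_nonneg hp]
  linarith

theorem integrable_right (h : IsEvenPair γ α) {F : E3 → ℂ} (hF : IsTame F) :
    Integrable fun p => (α p : ℂ) * F p := by
  refine integrable_weight_mul h.integrable h.measurable ?_ hF
  filter_upwards [h.nonneg, h.le] with p hp hp'
  linarith [abs_le_add_half hp hp']

theorem integrable_one_add (h : IsEvenPair γ α) {F : E3 → ℂ} (hF : IsTame F) :
    Integrable fun p => (1 + γ p : ℂ) * F p := by
  refine (hF.integrable.add (h.integrable_left hF)).congr (Filter.Eventually.of_forall fun p => ?_)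
  simp only [Pi.add_apply]
  ring

end IsEvenPair

theorem integral_even_mul {w : E3 → ℝ} (hw : IsEvenAE w) (F : E3 → ℂ) :
    ∫ p, (w p : ℂ) * F (-p) = ∫ p, (w p : ℂ) * F p := by
  rw [← integral_neg_eq_self]
  refine integral_congr_ae ?_
  filter_upwards [hw] with p hp
  rw [hp, neg_neg]

/-- The quadratic form of the one-particle density matrix at a pair of momenta `p, -p`. -/
def pairForm (g a : ℝ) (U V : ℂ) : ℝ :=
  (1 + g) * Complex.normSq U + g * Complex.normSq V + 2 * a * ((starRingEnd ℂ) V * U).re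

theorem two_mul_re_conj_mul_ge {A B a : ℝ} (hA : 0 ≤ A) (hB : 0 ≤ B) (h : a ^ 2 ≤ A * B)
    (U V : ℂ) :
    0 ≤ A * Complex.normSq U + B * Complex.normSq V + 2 * a * ((starRingEnd ℂ) V * U).re := by
  have h1 : |((starRingEnd ℂ) V * U).re| ≤ ‖V‖ * ‖U‖ := by
    refine (Complex.abs_re_le_norm _).trans ?_
    rw [norm_mul, RCLike.norm_conj]
  have h2 : |a| ≤ Real.sqrt A * Real.sqrt B := by
    rw [← Real.sqrt_mul hA, ← Real.sqrt_sq_eq_abs]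
    exact Real.sqrt_le_sqrt h
  have h3 : |a * ((starRingEnd ℂ) V * U).re| ≤ (Real.sqrt A * Real.sqrt B) * (‖V‖ * ‖U‖) := by
    rw [abs_mul]
    exact mul_le_mul h2 h1 (abs_nonneg _) (by positivity)
  have h4 := (abs_le.mp h3).1
  rw [Complex.normSq_eq_norm_sq, Complex.normSq_eq_norm_sq]
  nlinarith [sq_nonneg (Real.sqrt A * ‖U‖ - Real.sqrt B * ‖V‖), Real.sq_sqrt hA, Real.sq_sqrt hB]

theorem pairForm_nonneg {g a : ℝ} (hg : 0 ≤ g) (h : a ^ 2 ≤ g * (g + 1)) (U V : ℂ) :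
    0 ≤ pairForm g a U V :=
  two_mul_re_conj_mul_ge (by linarith) hg (by linarith) U V

/-- The covariance kernel of the quasi-free functional with density matrix given by `γ`, `α`. -/
def pairKernel (γ α : E3 → ℝ) : Matrix 𝓢(E3, ℂ) 𝓢(E3, ℂ) ℂ :=
  Matrix.of fun f g => ∫ p, ((1 + γ p : ℂ) * ((starRingEnd ℂ) (f p) * g p) +
    (γ p : ℂ) * (f (-p) * (starRingEnd ℂ) (g (-p))) +
    (α p : ℂ) * (f (-p) * g p + (starRingEnd ℂ) (f p) * (starRingEnd ℂ) (g (-p))))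

section PairKernel

variable {γ α : E3 → ℝ}

theorem isTame_conj_mul (f g : 𝓢(E3, ℂ)) : IsTame fun p => (starRingEnd ℂ) (f p) * g p :=
  (isTame_schwartz f).conj.mul (isTame_schwartz g)

theorem isTame_reflect_mul (f g : 𝓢(E3, ℂ)) : IsTame fun p => f (-p) * g p :=
  (isTame_schwartz f).reflect.mul (isTame_schwartz g)

theorem integrable_pairKernel (h : IsEvenPair γ α) (f g : 𝓢(E3, ℂ)) :
    Integrable fun p => ((1 + γ p : ℂ) * ((starRingEnd ℂ) (f p) * g p) +
      (γ p : ℂ) * (f (-p) * (starRingEnd ℂ) (g (-p))) +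
      (α p : ℂ) * (f (-p) * g p + (starRingEnd ℂ) (f p) * (starRingEnd ℂ) (g (-p)))) :=
  ((h.integrable_one_add (isTame_conj_mul f g)).add (h.integrable_left
    ((isTame_schwartz f).reflect.mul (isTame_schwartz g).reflect.conj))).add
    (h.integrable_right ((isTame_reflect_mul f g).add
      ((isTame_schwartz f).conj.mul (isTame_schwartz g).reflect.conj)))

theorem pairKernel_add_right (h : IsEvenPair γ α) (f g k : 𝓢(E3, ℂ)) :
    pairKernel γ α f (g + k) = pairKernel γ α f g + pairKernel γ α f k := by
  simp only [pairKernel, Matrix.of_apply]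
  rw [← integral_add (integrable_pairKernel h f g) (integrable_pairKernel h f k)]
  refine integral_congr_ae (Filter.Eventually.of_forall fun p => ?_)
  simp only [add_apply, map_add]
  ring

theorem pairKernel_smul_right (γ α : E3 → ℝ) (r : ℝ) (f g : 𝓢(E3, ℂ)) :
    pairKernel γ α f (r • g) = r * pairKernel γ α f g := by
  simp only [pairKernel, Matrix.of_apply]
  rw [← integral_const_mul]
  refine integral_congr_ae (Filter.Eventually.of_forall fun p => ?_)
  simp only [smul_apply, Complex.real_smul, map_mul, Complex.conj_ofReal]
  ring

/-- Evenness of `γ` and `α` turns the reflected terms into complex conjugates of the others. Hence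
the state-dependent part is real, and only the `L²` inner product has an imaginary part. -/
theorem pairKernel_eq (h : IsEvenPair γ α) (f g : 𝓢(E3, ℂ)) :
    pairKernel γ α f g = (∫ p, (starRingEnd ℂ) (f p) * g p) +
      ((∫ p, (2 * γ p * ((starRingEnd ℂ) (f p) * g p).re + 2 * α p * (f (-p) * g p).re) : ℝ) : ℂ) := by
  have t1 := isTame_conj_mul f g
  have t2 := (isTame_schwartz f).reflect.mul (isTame_schwartz g).reflect.conj
  have t3 := isTame_reflect_mul f g
  have t4 := (isTame_schwartz f).conj.mul (isTame_schwartz g).reflect.conj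
  have e2 : ∫ p, (γ p : ℂ) * (f (-p) * (starRingEnd ℂ) (g (-p))) =
      ∫ p, (γ p : ℂ) * (starRingEnd ℂ) ((starRingEnd ℂ) (f p) * g p) := by
    rw [← integral_even_mul h.even_left]
    simp
  have e4 : ∫ p, (α p : ℂ) * ((starRingEnd ℂ) (f p) * (starRingEnd ℂ) (g (-p))) =
      ∫ p, (α p : ℂ) * (starRingEnd ℂ) (f (-p) * g p) := by
    rw [← integral_even_mul h.even_right]
    simp
  have s1 : pairKernel γ α f g = (∫ p, (starRingEnd ℂ) (f p) * g p) +
      (∫ p, (γ p : ℂ) * ((starRingEnd ℂ) (f p) * g p)) +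
      (∫ p, (γ p : ℂ) * (f (-p) * (starRingEnd ℂ) (g (-p)))) +
      (∫ p, (α p : ℂ) * (f (-p) * g p)) +
      (∫ p, (α p : ℂ) * ((starRingEnd ℂ) (f p) * (starRingEnd ℂ) (g (-p)))) := by
    simp only [pairKernel, Matrix.of_apply]
    have i2 : Integrable fun p => (starRingEnd ℂ) (f p) * g p +
        (γ p : ℂ) * ((starRingEnd ℂ) (f p) * g p) := t1.integrable.add (h.integrable_left t1)
    have i3 : Integrable fun p => (starRingEnd ℂ) (f p) * g p +
        (γ p : ℂ) * ((starRingEnd ℂ) (f p) * g p) +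
        (γ p : ℂ) * (f (-p) * (starRingEnd ℂ) (g (-p))) := i2.add (h.integrable_left t2)
    have i4 : Integrable fun p => (starRingEnd ℂ) (f p) * g p +
        (γ p : ℂ) * ((starRingEnd ℂ) (f p) * g p) +
        (γ p : ℂ) * (f (-p) * (starRingEnd ℂ) (g (-p))) +
        (α p : ℂ) * (f (-p) * g p) := i3.add (h.integrable_right t3)
    rw [← integral_add t1.integrable (h.integrable_left t1), ← integral_add i2 (h.integrable_left t2),
      ← integral_add i3 (h.integrable_right t3), ← integral_add i4 (h.integrable_right t4)]
    refine integral_congr_ae (Filter.Eventually.of_forall fun p => ?_)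
    ring
  rw [s1, e2, e4, ← integral_complex_ofReal, add_assoc, add_assoc, add_assoc]
  congr 1
  have i2 : Integrable fun p => (α p : ℂ) * (f (-p) * g p) +
      (α p : ℂ) * (starRingEnd ℂ) (f (-p) * g p) :=
    (h.integrable_right t3).add (h.integrable_right t3.conj)
  have i3 : Integrable fun p => (γ p : ℂ) * (starRingEnd ℂ) ((starRingEnd ℂ) (f p) * g p) +
      ((α p : ℂ) * (f (-p) * g p) + (α p : ℂ) * (starRingEnd ℂ) (f (-p) * g p)) :=
    (h.integrable_left t1.conj).add i2
  rw [← integral_add (h.integrable_right t3) (h.integrable_right t3.conj),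
    ← integral_add (h.integrable_left t1.conj) i2, ← integral_add (h.integrable_left t1) i3]
  refine integral_congr_ae (Filter.Eventually.of_forall fun p => ?_)
  have hc : ∀ z : ℂ, (2 * z.re : ℂ) = z + (starRingEnd ℂ) z := fun z => by
    rw [Complex.add_conj]; push_cast; ring
  push_cast
  linear_combination (-(γ p : ℂ)) * hc ((starRingEnd ℂ) (f p) * g p) - (α p : ℂ) * hc (f (-p) * g p)

theorem pairKernel_im (h : IsEvenPair γ α) (f g : 𝓢(E3, ℂ)) :
    (pairKernel γ α f g).im = symp f g := by
  rw [pairKernel_eq h, Complex.add_im, Complex.ofReal_im, add_zero, symp]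

theorem pairKernel_re_diag (h : IsEvenPair γ α) (f : 𝓢(E3, ℂ)) :
    (pairKernel γ α f f).re = variance γ α f := by
  have t1 := isTame_conj_mul f f
  have t3 := isTame_reflect_mul f f
  have i1 := (h.integrable_left t1).re.const_mul 2
  have i3 := (h.integrable_right t3).re.const_mul 2
  rw [pairKernel_eq h, Complex.add_re, Complex.ofReal_re, variance]
  have : (∫ p, (starRingEnd ℂ) (f p) * f p).re = ∫ p, ((starRingEnd ℂ) (f p) * f p).re :=
    (integral_re t1.integrable).symm
  have i0 : Integrable fun p => ((starRingEnd ℂ) (f p) * f p).re := t1.integrable.re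
  rw [this, ← integral_add i0]
  · refine integral_congr_ae (Filter.Eventually.of_forall fun p => ?_)
    have hn : ((starRingEnd ℂ) (f p) * f p).re = ‖f p‖ ^ 2 := by
      rw [mul_comm, Complex.mul_conj, Complex.ofReal_re, Complex.normSq_eq_norm_sq]
    simp only [hn, mul_comm (f (-p))]
    ring
  · refine (i1.add i3).congr (Filter.Eventually.of_forall fun p => ?_)
    simp only [Pi.add_apply, RCLike.re_to_complex, Complex.re_ofReal_mul]
    ring

/-- The function `∑ c_f f(p)` of an element of the Weyl algebra. -/
def waveUp (x : Weyl) (p : E3) : ℂ := x.sum fun f c => c * f p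

/-- The function `∑ c_f conj (f(-p))` of an element of the Weyl algebra. -/
def waveDown (x : Weyl) (p : E3) : ℂ := x.sum fun f c => c * (starRingEnd ℂ) (f (-p))

theorem isTame_waveUp (x : Weyl) : IsTame (waveUp x) :=
  isTame_sum _ fun f _ => (isTame_schwartz f).const_mul _

theorem isTame_waveDown (x : Weyl) : IsTame (waveDown x) :=
  isTame_sum _ fun f _ => (isTame_schwartz f).reflect.conj.const_mul _

theorem pairForm_eq (g a : ℝ) (U V : ℂ) : ((pairForm g a U V : ℝ) : ℂ) =
    (1 + g : ℂ) * ((starRingEnd ℂ) U * U) + (g : ℂ) * ((starRingEnd ℂ) V * V) +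
      (a : ℂ) * ((starRingEnd ℂ) V * U + (starRingEnd ℂ) U * V) := by
  have hc := Complex.add_conj ((starRingEnd ℂ) V * U)
  simp only [map_mul, Complex.conj_conj] at hc
  simp only [pairForm, Complex.ofReal_add, Complex.ofReal_mul, Complex.normSq_eq_conj_mul_self]
  push_cast at hc ⊢
  linear_combination (-(a : ℂ)) * hc

theorem integrable_pairForm (h : IsEvenPair γ α) {U V : E3 → ℂ} (hU : IsTame U) (hV : IsTame V) :
    Integrable fun p => pairForm (γ p) (α p) (U p) (V p) := by
  have := ((h.integrable_one_add (hU.conj.mul hU)).add (h.integrable_left (hV.conj.mul hV))).add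
    (h.integrable_right ((hV.conj.mul hU).add (hU.conj.mul hV)))
  refine this.re.congr (Filter.Eventually.of_forall fun p => ?_)
  simp only [Pi.add_apply, ← pairForm_eq, RCLike.re_to_complex, Complex.ofReal_re]

/-- Since `K(f,g)` is sesquilinear in `f ↦ (f(p), conj f(-p))`, complex combinations enter through
their waves only, and positivity reduces to a two-by-two matrix at each momentum. -/
theorem kernelForm_pairKernel (h : IsEvenPair γ α) (x : Weyl) :
    kernelForm (pairKernel γ α) x x =
      ((∫ p, pairForm (γ p) (α p) (waveUp x p) (waveDown x p) : ℝ) : ℂ) := by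
  rw [← integral_complex_ofReal]
  have h1 : ∀ p, ((pairForm (γ p) (α p) (waveUp x p) (waveDown x p) : ℝ) : ℂ) =
      ∑ f ∈ x.support, ∑ g ∈ x.support, star (x f) * ((1 + γ p : ℂ) *
        ((starRingEnd ℂ) (f p) * g p) + (γ p : ℂ) * (f (-p) * (starRingEnd ℂ) (g (-p))) +
        (α p : ℂ) * (f (-p) * g p + (starRingEnd ℂ) (f p) * (starRingEnd ℂ) (g (-p)))) * x g := by
    intro p
    simp only [pairForm_eq, waveUp, waveDown, Finsupp.sum, map_sum, Finset.sum_mul_sum]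
    simp only [← Finset.sum_add_distrib, Finset.mul_sum]
    refine Finset.sum_congr rfl fun f _ => Finset.sum_congr rfl fun g _ => ?_
    simp only [map_mul, Complex.conj_conj, Complex.star_def]
    ring
  simp only [h1]
  have hint := fun f g : 𝓢(E3, ℂ) =>
    ((integrable_pairKernel h f g).const_mul (star (x f))).mul_const (x g)
  rw [integral_finsetSum _ fun f _ => integrable_finsetSum _ fun g _ => hint f g]
  unfold kernelForm Finsupp.sum
  refine Finset.sum_congr rfl fun f _ => ?_
  rw [integral_finsetSum _ fun g _ => hint f g]
  refine Finset.sum_congr rfl fun g _ => ?_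
  rw [integral_mul_const, integral_const_mul]
  rfl

theorem isCovariance_pairKernel (h : IsEvenPair γ α) : IsCovariance (pairKernel γ α) where
  posSemidef := by
    refine posSemidef_of_kernelForm fun x => ?_
    rw [kernelForm_pairKernel h]
    refine ⟨?_, Complex.ofReal_im _⟩
    rw [Complex.ofReal_re]
    refine integral_nonneg_of_ae ?_
    filter_upwards [h.nonneg, h.le] with p h1 h2
    exact pairForm_nonneg h1 h2 _ _
  add_right := pairKernel_add_right h
  smul_right := pairKernel_smul_right γ α
  im_eq := pairKernel_im h

end PairKernel

/-- The mean of the field in the Bogoliubov state with condensate density `ρ₀`. -/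
def condensateMean (ρ₀ : ℝ) : 𝓢(E3, ℂ) →+ ℝ where
  toFun f := Real.sqrt 2 * (2 * Real.pi) ^ (3 / 2 : ℝ) * Real.sqrt ρ₀ * (f 0).re
  map_zero' := by simp
  map_add' f g := by
    simp only [add_apply, Complex.add_re]
    ring

theorem bogoliubovState_eq {γ α : E3 → ℝ} (h : IsEvenPair γ α) (ρ₀ : ℝ) :
    bogoliubovState γ α ρ₀ = gaussianFunctional (pairKernel γ α) (condensateMean ρ₀) := by
  refine weyl_ext fun f => ?_
  rw [gaussianFunctional_weylOp, gaussianAmp, pairKernel_re_diag h]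
  simp [bogoliubovState, weylOp, condensateMean]

/-! ## Purity of quasi-free states -/

/-- Schwartz functions are dense in the weighted space `L²((1+γ)dp)`. -/
theorem exists_schwartz_approx {γ : E3 → ℝ} (hγ : Integrable γ) (hγ0 : ∀ᵐ p, 0 ≤ γ p)
    {F : E3 → ℂ} (hF : AEStronglyMeasurable F volume)
    (hFi : Integrable fun p => (1 + γ p) * ‖F p‖ ^ 2) {ε : ℝ} (hε : 0 < ε) :
    ∃ k : 𝓢(E3, ℂ), Integrable (fun p => (1 + γ p) * ‖k p - F p‖ ^ 2) ∧
      ∫ p, (1 + γ p) * ‖k p - F p‖ ^ 2 ≤ ε := by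
  set w : E3 → NNReal := fun p => (1 + γ p).toNNReal with hw
  have hwm : AEMeasurable w volume := (hγ.1.aemeasurable.const_add 1).real_toNNReal
  have hwe : ∀ᵐ p, (w p : ℝ) = 1 + γ p := by
    filter_upwards [hγ0] with p hp
    exact Real.coe_toNNReal _ (by linarith)
  set ν : Measure E3 := volume.withDensity fun p => (w p : ENNReal) with hν
  have hac : ν ≪ volume := withDensity_absolutelyContinuous _ _
  -- Local finiteness is what makes smooth compactly supported functions dense in `L²(ν)`.
  have : IsFiniteMeasureOnCompacts ν := by
    refine ⟨fun K hK => ?_⟩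
    rw [hν, withDensity_apply _ hK.measurableSet]
    have hi : IntegrableOn (fun p => 1 + γ p) K :=
      (integrableOn_const hK.measure_lt_top.ne).add hγ.integrableOn
    exact hi.lintegral_lt_top
  have hFν : MemLp F 2 ν := by
    rw [memLp_two_iff_integrable_sq_norm (hF.mono_ac hac), hν,
      integrable_withDensity_iff_integrable_smul₀ hwm]
    refine hFi.congr ?_
    filter_upwards [hwe] with p hp
    rw [NNReal.smul_def, hp, smul_eq_mul]
  obtain ⟨g, hg1, hg2, hg3⟩ := hFν.exist_eLpNorm_sub_le (by simp) (by norm_num)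
    (Real.sqrt_pos.mpr hε)
  have hgν : MemLp (F - g) 2 ν :=
    hFν.sub (hg2.continuous.memLp_of_hasCompactSupport hg1)
  have hsq := (memLp_two_iff_integrable_sq_norm hgν.1).mp hgν
  refine ⟨hg1.toSchwartzMap hg2, ?_, ?_⟩
  · rw [hν, integrable_withDensity_iff_integrable_smul₀ hwm] at hsq
    refine hsq.congr ?_
    filter_upwards [hwe] with p hp
    rw [NNReal.smul_def, hp, smul_eq_mul, Pi.sub_apply, norm_sub_rev]
    rfl
  · rw [hgν.eLpNorm_eq_integral_rpow_norm (by simp) (by simp),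
      ENNReal.ofReal_le_ofReal_iff (Real.sqrt_nonneg _)] at hg3
    have e1 : ∫ p, ‖(F - g) p‖ ^ (2 : ENNReal).toReal ∂ν =
        ∫ p, (1 + γ p) * ‖(hg1.toSchwartzMap hg2) p - F p‖ ^ 2 := by
      rw [hν, integral_withDensity_eq_integral_smul₀ hwm]
      refine integral_congr_ae ?_
      filter_upwards [hwe] with p hp
      rw [NNReal.smul_def, hp, smul_eq_mul, Pi.sub_apply, norm_sub_rev]
      simp
    rw [e1] at hg3
    have h0 : 0 ≤ ∫ p, (1 + γ p) * ‖(hg1.toSchwartzMap hg2) p - F p‖ ^ 2 := by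
      refine integral_nonneg_of_ae ?_
      filter_upwards [hγ0] with p hp
      simp only [Pi.zero_apply]
      positivity
    rw [ENNReal.toReal_ofNat, ← one_div, ← Real.sqrt_eq_rpow] at hg3
    exact (Real.sqrt_le_sqrt_iff hε.le).mp hg3

theorem pairForm_add_le {g a : ℝ} (hg : 0 ≤ g) (h : a ^ 2 ≤ g * (g + 1)) (U V U' V' : ℂ) :
    pairForm g a (U + U') (V + V') ≤ 2 * pairForm g a U V + 2 * pairForm g a U' V' := by
  have h1 := pairForm_nonneg hg h (U - U') (V - V')
  have h2 : pairForm g a (U + U') (V + V') + pairForm g a (U - U') (V - V') =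
      2 * pairForm g a U V + 2 * pairForm g a U' V' := by
    simp [pairForm, Complex.normSq_apply]
    ring
  linarith

theorem pairForm_le {g a : ℝ} (hg : 0 ≤ g) (h : a ^ 2 ≤ g * (g + 1)) (U V : ℂ) :
    pairForm g a U V ≤ 2 * (1 + g) * (‖U‖ ^ 2 + ‖V‖ ^ 2) := by
  have h1 : |((starRingEnd ℂ) V * U).re| ≤ ‖V‖ * ‖U‖ := by
    refine (Complex.abs_re_le_norm _).trans ?_
    rw [norm_mul, RCLike.norm_conj]
  have h2 := abs_le_add_half hg h
  have h3 : a * ((starRingEnd ℂ) V * U).re ≤ (g + 1 / 2) * (‖V‖ * ‖U‖) := by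
    refine (le_abs_self _).trans ?_
    rw [abs_mul]
    exact mul_le_mul h2 h1 (abs_nonneg _) (by linarith)
  rw [pairForm, Complex.normSq_eq_norm_sq, Complex.normSq_eq_norm_sq]
  nlinarith [mul_nonneg hg (sq_nonneg (‖U‖ - ‖V‖)), sq_nonneg (‖U‖ - ‖V‖),
    mul_nonneg hg (sq_nonneg ‖U‖)]

/-- The null vectors of the density matrix of a pure state. -/
theorem pairForm_null {g a : ℝ} (h : a ^ 2 = g * (g + 1)) (u v : ℂ) :
    pairForm g a (u + Complex.I * (Complex.I * ((1 + 2 * g) * u + 2 * a * v)))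
      (v + Complex.I * (starRingEnd ℂ) (Complex.I *
        ((1 + 2 * g) * (starRingEnd ℂ) v + 2 * a * (starRingEnd ℂ) u))) = 0 := by
  have e1 : u + Complex.I * (Complex.I * ((1 + 2 * g) * u + 2 * a * v)) =
      ((-2 * g : ℝ) : ℂ) * u + ((-2 * a : ℝ) : ℂ) * v := by
    push_cast
    linear_combination ((1 + 2 * g) * u + 2 * a * v) * Complex.I_sq
  have e2 : v + Complex.I * (starRingEnd ℂ) (Complex.I *
        ((1 + 2 * g) * (starRingEnd ℂ) v + 2 * a * (starRingEnd ℂ) u)) =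
      ((2 * (1 + g) : ℝ) : ℂ) * v + ((2 * a : ℝ) : ℂ) * u := by
    simp only [map_mul, map_add, map_one, Complex.conj_I, Complex.conj_conj, Complex.conj_ofReal,
      Complex.conj_ofNat]
    push_cast
    linear_combination (-((1 + 2 * g) * v + 2 * a * u)) * Complex.I_sq
  -- The vector is `2u (-g, a) + 2v (-a, 1+g)`, and both columns are annihilated by the matrix with
  -- rows `(1+g, a)` and `(a, g)` when `a² = g(g+1)`.
  rw [e1, e2]
  simp only [pairForm, Complex.normSq_apply, Complex.add_re, Complex.add_im,
    Complex.mul_re, Complex.mul_im, Complex.ofReal_re, Complex.ofReal_im, Complex.conj_re,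
    Complex.conj_im]
  linear_combination (-4 * (1 + g) * (v.re ^ 2 + v.im ^ 2) - 4 * g * (u.re ^ 2 + u.im ^ 2)
    - 8 * a * (u.re * v.re + u.im * v.im)) * h

/-- The ideal partner of `f` is `k = i((1+2γ) f + 2α conj f(-·))`, which makes `f + i k` null at
every momentum. It need not be smooth or decay suitably, so it is cut off to `γ ≤ n`, where it is
bounded in terms of `f`, and approximated in `L²((1+γ)dp)`. Outside the cutoff the form of `f` alone
remains, an integrable tail. -/
theorem exists_kernel_defect_lt {γ α : E3 → ℝ} (h : IsEvenPair γ α) (hp : PurityRelation γ α)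
    (f : 𝓢(E3, ℂ)) {ε : ℝ} (hε : 0 < ε) :
    ∃ k, (pairKernel γ α f f).re + (pairKernel γ α k k).re - 2 * symp f k < ε := by
  have hf := isTame_schwartz f
  -- the tail of the form over large values of `γ`
  have hQ := integrable_pairForm h hf hf.reflect.conj
  have htail : Filter.Tendsto (fun n : ℕ => ∫ p, {p | (n : ℝ) < γ p}.indicator
      (fun p => pairForm (γ p) (α p) (f p) ((starRingEnd ℂ) (f (-p)))) p) Filter.atTop
      (𝓝 (∫ _ : E3, (0 : ℝ))) := by
    have hnull : ∀ n : ℕ, NullMeasurableSet {p | (n : ℝ) < γ p} volume := fun n =>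
      nullMeasurableSet_lt aemeasurable_const h.integrable.1.aemeasurable
    refine tendsto_integral_of_dominated_convergence
      (fun p => |pairForm (γ p) (α p) (f p) ((starRingEnd ℂ) (f (-p)))|)
      (fun n => hQ.1.indicator₀ (hnull n)) hQ.abs (fun n => Filter.Eventually.of_forall fun p => ?_)
      (Filter.Eventually.of_forall fun p => ?_)
    · exact norm_indicator_le_norm_self _ _
    · obtain ⟨N, hN⟩ := exists_nat_ge (γ p)
      refine tendsto_const_nhds.congr' ?_
      filter_upwards [Filter.eventually_ge_atTop N] with n hn
      rw [Set.indicator_of_notMem]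
      simp only [Set.mem_ofPred_eq, not_lt]
      exact hN.trans (by exact_mod_cast hn)
  rw [integral_zero] at htail
  -- The final estimate carries the tail with factor `2` and two approximation errors with factor
  -- `4`; the budgets `ε/4` and `ε/32` add up to `3ε/4`.
  obtain ⟨n, hn⟩ := (htail.eventually_lt_const (show (0 : ℝ) < ε / 4 by positivity)).exists
  -- the truncated target
  set S : Set E3 := {p | γ p ≤ n} with hS
  have hSm : NullMeasurableSet S volume :=
    nullMeasurableSet_le h.integrable.1.aemeasurable aemeasurable_const
  set G : E3 → ℂ := fun p => Complex.I * ((1 + 2 * γ p) * f p +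
    2 * α p * (starRingEnd ℂ) (f (-p))) with hG
  set F : E3 → ℂ := S.indicator G with hFdef
  have hGm : AEStronglyMeasurable G volume := by
    have a1 := Complex.continuous_ofReal.comp_aestronglyMeasurable h.integrable.1
    have a2 := Complex.continuous_ofReal.comp_aestronglyMeasurable h.measurable
    exact (((a1.const_mul 2).const_add 1).mul hf.continuous.aestronglyMeasurable |>.add
      ((a2.const_mul 2).mul hf.reflect.conj.continuous.aestronglyMeasurable)).const_mul _
  have hFm : AEStronglyMeasurable F volume := hGm.indicator₀ hSm
  have hFb : ∀ᵐ p, ‖F p‖ ≤ (1 + 2 * n) * (‖f p‖ + ‖f (-p)‖) := by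
    filter_upwards [h.nonneg, h.le] with p h0 h1
    by_cases hpS : p ∈ S
    · have hpn : γ p ≤ n := hpS
      rw [hFdef, Set.indicator_of_mem hpS, hG]
      have h2 := abs_le_add_half h0 h1
      have e1 : ‖(1 + 2 * γ p : ℂ)‖ = 1 + 2 * γ p := by
        rw [show (1 + 2 * γ p : ℂ) = ((1 + 2 * γ p : ℝ) : ℂ) by push_cast; ring, Complex.norm_real,
          Real.norm_of_nonneg (by linarith)]
      have e2 : ‖(2 * α p : ℂ)‖ = 2 * |α p| := by
        simp
      simp only [norm_mul, Complex.norm_I, one_mul]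
      refine (norm_add_le _ _).trans ?_
      rw [norm_mul, norm_mul, e1, e2, RCLike.norm_conj]
      nlinarith [norm_nonneg (f p), norm_nonneg (f (-p)),
        mul_nonneg (sub_nonneg.mpr hpn) (norm_nonneg (f p)),
        mul_nonneg (sub_nonneg.mpr hpn) (norm_nonneg (f (-p))),
        mul_nonneg (sub_nonneg.mpr h2) (norm_nonneg (f (-p)))]
    · rw [hFdef, Set.indicator_of_notMem hpS, norm_zero]
      positivity
  have hFi : Integrable fun p => (1 + γ p) * ‖F p‖ ^ 2 := by
    have b1 := (h.integrable_one_add (hf.conj.mul hf)).norm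
    have b2 := (h.integrable_one_add (hf.reflect.conj.mul hf.reflect)).norm
    refine ((b1.add b2).const_mul (2 * (1 + 2 * n) ^ 2)).mono'
      ((h.integrable.1.const_add 1).mul (hFm.norm.pow 2)) ?_
    filter_upwards [h.nonneg, hFb] with p h0 h1
    have e1 : ‖(1 + γ p : ℂ)‖ = 1 + γ p := by
      rw [show (1 + γ p : ℂ) = ((1 + γ p : ℝ) : ℂ) by push_cast; ring, Complex.norm_real,
        Real.norm_of_nonneg (by linarith)]
    have e3 : ‖F p‖ ^ 2 ≤ 2 * (1 + 2 * n) ^ 2 * (‖f p‖ ^ 2 + ‖f (-p)‖ ^ 2) := by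
      have := pow_le_pow_left₀ (norm_nonneg _) h1 2
      rw [mul_pow] at this
      nlinarith [mul_nonneg (sq_nonneg (1 + 2 * (n : ℝ))) (sq_nonneg (‖f p‖ - ‖f (-p)‖))]
    rw [Real.norm_of_nonneg (by positivity)]
    simp only [Pi.add_apply, norm_mul, RCLike.norm_conj, e1]
    nlinarith [mul_le_mul_of_nonneg_left e3 (show 0 ≤ 1 + γ p by linarith)]
  obtain ⟨k, hki, hk⟩ := exists_schwartz_approx h.integrable h.nonneg hFm hFi
    (show 0 < ε / 32 by positivity)
  refine ⟨k, ?_⟩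
  set z : Weyl := Finsupp.single f 1 + Complex.I • Finsupp.single k 1 with hz
  have hform : kernelForm (pairKernel γ α) z z =
      (((pairKernel γ α f f).re + (pairKernel γ α k k).re - 2 * symp f k : ℝ) : ℂ) := by
    rw [← (isCovariance_pairKernel h).kernel_defect_eq]
    simp only [hz, kernelForm_add_left, kernelForm_add_right, kernelForm_smul_left,
      kernelForm_smul_right, kernelForm_single, star_one, one_mul, mul_one, Complex.star_def,
      Complex.conj_I]
    linear_combination (-(pairKernel γ α k k)) * Complex.I_sq
  have hup : ∀ p, waveUp z p = f p + Complex.I * k p := by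
    intro p
    simp only [hz, waveUp, Finsupp.smul_single, smul_eq_mul, mul_one]
    rw [Finsupp.sum_add_index' (by simp) (fun _ _ _ => add_mul _ _ _),
      Finsupp.sum_single_index (by simp), Finsupp.sum_single_index (by simp), one_mul]
  have hdown : ∀ p, waveDown z p = (starRingEnd ℂ) (f (-p)) + Complex.I *
      (starRingEnd ℂ) (k (-p)) := by
    intro p
    simp only [hz, waveDown, Finsupp.smul_single, smul_eq_mul, mul_one]
    rw [Finsupp.sum_add_index' (by simp) (fun _ _ _ => add_mul _ _ _),
      Finsupp.sum_single_index (by simp), Finsupp.sum_single_index (by simp), one_mul]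
  rw [kernelForm_pairKernel h, Complex.ofReal_inj] at hform
  rw [← hform]
  have hki' : Integrable fun p => (1 + γ p) * ‖k (-p) - F (-p)‖ ^ 2 := by
    refine hki.comp_neg.congr ?_
    filter_upwards [h.even_left] with p h1
    rw [h1]
  have hk' : ∫ p, (1 + γ p) * ‖k (-p) - F (-p)‖ ^ 2 ≤ ε / 32 := by
    rw [← integral_neg_eq_self] at hk
    refine le_trans (le_of_eq (integral_congr_ae ?_)) hk
    filter_upwards [h.even_left] with p h1
    rw [h1]
  have hbound : ∀ᵐ p, pairForm (γ p) (α p) (waveUp z p) (waveDown z p) ≤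
      2 * {p | (n : ℝ) < γ p}.indicator
        (fun p => pairForm (γ p) (α p) (f p) ((starRingEnd ℂ) (f (-p)))) p +
      4 * ((1 + γ p) * ‖k p - F p‖ ^ 2 + (1 + γ p) * ‖k (-p) - F (-p)‖ ^ 2) := by
    filter_upwards [h.nonneg, h.le, hp, h.even_left, h.even_right] with p h0 h1 h2 h3 h4
    have e1 : waveUp z p = (f p + Complex.I * F p) + Complex.I * (k p - F p) := by
      rw [hup]; ring
    have e2 : waveDown z p = ((starRingEnd ℂ) (f (-p)) + Complex.I * (starRingEnd ℂ) (F (-p))) +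
        Complex.I * (starRingEnd ℂ) (k (-p) - F (-p)) := by
      rw [hdown, map_sub]; ring
    rw [e1, e2]
    refine (pairForm_add_le h0 h1 _ _ _ _).trans ?_
    have h5 := pairForm_le h0 h1 (Complex.I * (k p - F p))
      (Complex.I * (starRingEnd ℂ) (k (-p) - F (-p)))
    rw [norm_mul, norm_mul, Complex.norm_I, one_mul, one_mul, RCLike.norm_conj] at h5
    have h6 : pairForm (γ p) (α p) (f p + Complex.I * F p)
        ((starRingEnd ℂ) (f (-p)) + Complex.I * (starRingEnd ℂ) (F (-p))) =
        {p | (n : ℝ) < γ p}.indicator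
        (fun p => pairForm (γ p) (α p) (f p) ((starRingEnd ℂ) (f (-p)))) p := by
      -- Evenness of `γ` puts `p` and `-p` on the same side of the cutoff, so both components are
      -- null vectors together or both untouched.
      by_cases hpS : γ p ≤ n
      · have hm : -p ∈ S := by
          rw [hS, Set.mem_ofPred_eq, h3]
          exact hpS
        have hm' : p ∈ S := hpS
        rw [hFdef, Set.indicator_of_mem hm, Set.indicator_of_mem hm', Set.indicator_of_notMem
          (by simpa using hpS), hG]
        have := pairForm_null h2 (f p) ((starRingEnd ℂ) (f (-p)))
        rw [Complex.conj_conj] at this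
        simp only [h3, h4, neg_neg]
        exact this
      · have hm : -p ∉ S := by
          rw [hS, Set.mem_ofPred_eq, h3]
          exact hpS
        have hm' : p ∉ S := hpS
        rw [hFdef, Set.indicator_of_notMem hm, Set.indicator_of_notMem hm', Set.indicator_of_mem
          (by simpa using hpS)]
        simp
    rw [h6]
    linarith
  have hnm : NullMeasurableSet {p | (n : ℝ) < γ p} volume :=
    nullMeasurableSet_lt aemeasurable_const h.integrable.1.aemeasurable
  have i1 : Integrable ({p | (n : ℝ) < γ p}.indicator
        (fun p => pairForm (γ p) (α p) (f p) ((starRingEnd ℂ) (f (-p))))) :=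
    hQ.indicator₀ hnm
  have i2 : Integrable fun p => (1 + γ p) * ‖k p - F p‖ ^ 2 + (1 + γ p) * ‖k (-p) - F (-p)‖ ^ 2 :=
    hki.add hki'
  calc ∫ p, pairForm (γ p) (α p) (waveUp z p) (waveDown z p)
      ≤ ∫ p, (2 * {p | (n : ℝ) < γ p}.indicator
        (fun p => pairForm (γ p) (α p) (f p) ((starRingEnd ℂ) (f (-p)))) p +
      4 * ((1 + γ p) * ‖k p - F p‖ ^ 2 + (1 + γ p) * ‖k (-p) - F (-p)‖ ^ 2)) :=
        integral_mono_ae (integrable_pairForm h (isTame_waveUp z) (isTame_waveDown z))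
          ((i1.const_mul 2).add (i2.const_mul 4)) hbound
    _ = 2 * (∫ p, {p | (n : ℝ) < γ p}.indicator
        (fun p => pairForm (γ p) (α p) (f p) ((starRingEnd ℂ) (f (-p)))) p) +
        4 * ((∫ p, (1 + γ p) * ‖k p - F p‖ ^ 2) + ∫ p, (1 + γ p) * ‖k (-p) - F (-p)‖ ^ 2) := by
        rw [integral_add (i1.const_mul 2) (i2.const_mul 4), integral_const_mul, integral_const_mul,
          integral_add hki hki']
    _ < ε := by linarith

/-- A Bogoliubov state whose density matrix satisfies the purity relation is pure. -/
theorem isPureState_bogoliubovState {γ α : E3 → ℝ} (h : IsEvenPair γ α) (hp : PurityRelation γ α)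
    (ρ₀ : ℝ) : IsPureState (bogoliubovState γ α ρ₀) := by
  rw [bogoliubovState_eq h]
  exact (isCovariance_pairKernel h).isPureState_gaussianFunctional _ fun f ε hε =>
    exists_kernel_defect_lt h hp f hε

/-! ## States with a strict inequality are mixed -/

/-- A lower bound for the smallest eigenvalue of the density matrix at `p`. -/
def mixedness (γ α : E3 → ℝ) (p : E3) : ℝ := (γ p * (γ p + 1) - α p ^ 2) / (1 + 2 * γ p)

theorem mixedness_nonneg {γ α : E3 → ℝ} (h : IsEvenPair γ α) : ∀ᵐ p, 0 ≤ mixedness γ α p := by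
  filter_upwards [h.nonneg, h.le] with p h0 h1
  exact div_nonneg (by linarith) (by linarith)

theorem integrable_mixedness {γ α : E3 → ℝ} (h : IsEvenPair γ α) : Integrable (mixedness γ α) := by
  refine h.integrable.mono' (AEMeasurable.aestronglyMeasurable ?_) ?_
  · have h1 := h.integrable.1.aemeasurable
    have h2 := h.measurable.aemeasurable
    exact ((h1.mul (h1.add_const 1)).sub (h2.pow_const 2)).div ((h1.const_mul 2).const_add 1)
  · filter_upwards [h.nonneg, mixedness_nonneg h] with p h0 h1
    rw [Real.norm_of_nonneg h1, mixedness, div_le_iff₀ (by linarith)]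
    nlinarith [sq_nonneg (α p)]

theorem isEvenAE_mixedness {γ α : E3 → ℝ} (h : IsEvenPair γ α) : IsEvenAE (mixedness γ α) := by
  filter_upwards [h.even_left, h.even_right] with p h1 h2
  rw [mixedness, mixedness, h1, h2]

theorem integrable_mixedness_mul {γ α : E3 → ℝ} (h : IsEvenPair γ α) {F : E3 → ℂ}
    (hF : IsTame F) : Integrable fun p => (mixedness γ α p : ℂ) * F p := by
  obtain ⟨C, hC⟩ := hF.bounded
  refine ((integrable_mixedness h).norm.mul_const C).mono'
    ((Complex.continuous_ofReal.comp_aestronglyMeasurable (integrable_mixedness h).1).mul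
      hF.continuous.aestronglyMeasurable) (Filter.Eventually.of_forall fun p => ?_)
  rw [norm_mul, Complex.norm_real]
  exact mul_le_mul_of_nonneg_left (hC p) (norm_nonneg _)

/-- Determinant over trace is a lower bound `d` for the smaller eigenvalue: after subtracting `d`
from the diagonal the determinant is still at least `d² ≥ 0`. The mean of `U` and `V` is then
dominated by `|U|² + |V|²`. -/
theorem mixedness_mul_le {γ α : E3 → ℝ} {p : E3} (h0 : 0 ≤ γ p)
    (h1 : α p ^ 2 ≤ γ p * (γ p + 1)) (U V : ℂ) :
    mixedness γ α p * Complex.normSq ((U + V) / 2) ≤ pairForm (γ p) (α p) U V := by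
  set d := mixedness γ α p with hd
  have hd0 : 0 ≤ d := div_nonneg (by linarith) (by linarith)
  have hdm : d * (1 + 2 * γ p) = γ p * (γ p + 1) - α p ^ 2 := by
    rw [hd, mixedness, div_mul_cancel₀]
    linarith
  have hdle : d ≤ γ p := by
    rw [hd, mixedness, div_le_iff₀ (by linarith)]
    nlinarith [sq_nonneg (α p)]
  have h2 := two_mul_re_conj_mul_ge (A := 1 + γ p - d) (B := γ p - d) (a := α p) (by linarith)
    (by linarith) (by nlinarith) U V
  have h3 : Complex.normSq ((U + V) / 2) ≤ Complex.normSq U + Complex.normSq V := by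
    simp only [Complex.normSq_apply, Complex.div_ofNat_re, Complex.div_ofNat_im, Complex.add_re,
      Complex.add_im]
    nlinarith [sq_nonneg (U.re - V.re), sq_nonneg (U.im - V.im), sq_nonneg (U.re),
      sq_nonneg (V.re), sq_nonneg (U.im), sq_nonneg (V.im)]
  have h4 := mul_le_mul_of_nonneg_left h3 hd0
  rw [pairForm]
  linarith

/-- The field averaged with the weight `mixedness`. -/
def mixedFunctional {γ α : E3 → ℝ} (h : IsEvenPair γ α) : 𝓢(E3, ℂ) →ₗ[ℝ] ℝ where
  toFun f := ∫ p, mixedness γ α p * (f p).re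
  map_add' f g := by
    have hi : ∀ f : 𝓢(E3, ℂ), Integrable fun p => mixedness γ α p * (f p).re := fun f => by
      refine (integrable_mixedness_mul h (isTame_schwartz f)).re.congr
        (Filter.Eventually.of_forall fun p => ?_)
      simp
    rw [← integral_add (hi f) (hi g)]
    refine integral_congr_ae (Filter.Eventually.of_forall fun p => ?_)
    simp only [add_apply, Complex.add_re]
    ring
  map_smul' r f := by
    rw [smul_eq_mul, RingHom.id_apply, ← integral_const_mul]
    refine integral_congr_ae (Filter.Eventually.of_forall fun p => ?_)
    simp only [smul_apply, Complex.real_smul, Complex.re_ofReal_mul]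
    ring

/-- Evenness of the weight replaces the real part of `f` by the mean of `f(p)` and `conj f(-p)`,
which extends complex-linearly to `(waveUp + waveDown)/2`. -/
theorem mixedFunctional_eq {γ α : E3 → ℝ} (h : IsEvenPair γ α) (f : 𝓢(E3, ℂ)) :
    ((mixedFunctional h f : ℝ) : ℂ) =
      ∫ p, (mixedness γ α p : ℂ) * ((f p + (starRingEnd ℂ) (f (-p))) / 2) := by
  have hf := isTame_schwartz f
  have e1 : ∫ p, (mixedness γ α p : ℂ) * (starRingEnd ℂ) (f (-p)) =
      ∫ p, (mixedness γ α p : ℂ) * (starRingEnd ℂ) (f p) :=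
    integral_even_mul (isEvenAE_mixedness h) fun p => (starRingEnd ℂ) (f p)
  have e2 : ∫ p, (mixedness γ α p : ℂ) * ((f p + (starRingEnd ℂ) (f (-p))) / 2) =
      ((∫ p, (mixedness γ α p : ℂ) * f p) +
        ∫ p, (mixedness γ α p : ℂ) * (starRingEnd ℂ) (f (-p))) / 2 := by
    rw [← integral_add (integrable_mixedness_mul h hf)
      (integrable_mixedness_mul h hf.reflect.conj), ← integral_div]
    refine integral_congr_ae (Filter.Eventually.of_forall fun p => ?_)
    ring
  rw [e2, e1, ← integral_add (integrable_mixedness_mul h hf) (integrable_mixedness_mul h hf.conj),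
    ← integral_div]
  change ((∫ p, mixedness γ α p * (f p).re : ℝ) : ℂ) = _
  rw [← integral_complex_ofReal]
  refine integral_congr_ae (Filter.Eventually.of_forall fun p => ?_)
  have := Complex.add_conj (f p)
  push_cast at this ⊢
  linear_combination (-(mixedness γ α p : ℂ) / 2) * this

/-- Pointwise the form dominates `mixedness · |w|²` with `w` the mean of the two waves;
Cauchy–Schwarz with respect to the finite measure `mixedness dp` bounds its integral below by `|∫
mixedness · w|² / ∫ mixedness`. -/
theorem posSemidef_reduced_pairKernel {γ α : E3 → ℝ} (h : IsEvenPair γ α)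
    (hC : 0 < ∫ p, mixedness γ α p) :
    (reducedKernel (pairKernel γ α) (mixedFunctional h) (∫ p, mixedness γ α p)⁻¹).PosSemidef := by
  set C := ∫ p, mixedness γ α p with hCdef
  refine posSemidef_of_kernelForm fun x => ?_
  set w : E3 → ℂ := fun p => (waveUp x p + waveDown x p) / 2 with hw
  have hwt : IsTame w := by
    have := ((isTame_waveUp x).add (isTame_waveDown x)).const_mul (1 / 2)
    convert this using 2
    simp only [hw]
    ring
  set m : ℂ := ∫ p, (mixedness γ α p : ℂ) * w p with hm
  have hm' : m = ∑ f ∈ x.support, x f * (mixedFunctional h f : ℂ) := by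
    simp only [mixedFunctional_eq]
    simp only [← integral_const_mul]
    rw [← integral_finsetSum _ fun f _ => ?_]
    · rw [hm]
      refine integral_congr_ae (Filter.Eventually.of_forall fun p => ?_)
      simp only [hw, waveUp, waveDown, Finsupp.sum, ← Finset.sum_add_distrib, Finset.sum_div,
        Finset.mul_sum]
      refine Finset.sum_congr rfl fun f _ => ?_
      ring
    · have hf := isTame_schwartz f
      refine Integrable.const_mul ?_ _
      have := integrable_mixedness_mul h ((hf.add hf.reflect.conj).const_mul (1 / 2))
      refine this.congr (Filter.Eventually.of_forall fun p => ?_)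
      simp only
      ring
  have hform : kernelForm (reducedKernel (pairKernel γ α) (mixedFunctional h) C⁻¹) x x =
      (((∫ p, pairForm (γ p) (α p) (waveUp x p) (waveDown x p)) - C⁻¹ * Complex.normSq m : ℝ) : ℂ) := by
    rw [Complex.ofReal_sub, ← kernelForm_pairKernel h, Complex.ofReal_mul,
      Complex.normSq_eq_conj_mul_self, hm', map_sum, Finset.sum_mul_sum, Finset.mul_sum]
    unfold kernelForm Finsupp.sum
    rw [← Finset.sum_sub_distrib]
    refine Finset.sum_congr rfl fun f _ => ?_
    rw [Finset.mul_sum, ← Finset.sum_sub_distrib]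
    refine Finset.sum_congr rfl fun g _ => ?_
    simp only [reducedKernel, Matrix.of_apply, map_mul, Complex.conj_ofReal, Complex.star_def]
    push_cast
    ring
  rw [hform]
  refine ⟨?_, Complex.ofReal_im _⟩
  rw [Complex.ofReal_re, sub_nonneg]
  -- integrate the pointwise bound `|w|² ≥ 2 Re (conj n w) - |n|²` with `n = m / C`
  set n : ℂ := m / C with hn
  have hi1 : Integrable fun p => 2 * ((mixedness γ α p : ℂ) * ((starRingEnd ℂ) n * w p)).re :=
    (integrable_mixedness_mul h (hwt.const_mul _)).re.const_mul 2
  have hi2 : Integrable fun p => mixedness γ α p * Complex.normSq n :=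
    (integrable_mixedness h).mul_const _
  have hle : ∫ p, (2 * ((mixedness γ α p : ℂ) * ((starRingEnd ℂ) n * w p)).re -
      mixedness γ α p * Complex.normSq n) ≤
      ∫ p, pairForm (γ p) (α p) (waveUp x p) (waveDown x p) := by
    refine integral_mono_ae (hi1.sub hi2)
      (integrable_pairForm h (isTame_waveUp x) (isTame_waveDown x)) ?_
    filter_upwards [h.nonneg, h.le, mixedness_nonneg h] with p h0 h1 h2
    refine le_trans ?_ (mixedness_mul_le h0 h1 (waveUp x p) (waveDown x p))
    have h3 := mul_nonneg h2 (Complex.normSq_nonneg (w p - n))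
    have h4 : Complex.normSq (w p - n) = Complex.normSq (w p) -
        2 * ((starRingEnd ℂ) n * w p).re + Complex.normSq n := by
      simp [Complex.normSq_apply]
      ring
    rw [h4] at h3
    rw [Complex.re_ofReal_mul]
    simp only [hw] at h3 ⊢
    linarith
  have hval : ∫ p, (2 * ((mixedness γ α p : ℂ) * ((starRingEnd ℂ) n * w p)).re -
      mixedness γ α p * Complex.normSq n) = C⁻¹ * Complex.normSq m := by
    rw [integral_sub hi1 hi2, integral_const_mul, integral_mul_const, ← hCdef]
    have e1 : ∫ p, ((mixedness γ α p : ℂ) * ((starRingEnd ℂ) n * w p)).re =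
        (∫ p, (mixedness γ α p : ℂ) * ((starRingEnd ℂ) n * w p)).re :=
      integral_re (integrable_mixedness_mul h (hwt.const_mul _))
    have e2 : ∫ p, (mixedness γ α p : ℂ) * ((starRingEnd ℂ) n * w p) = (starRingEnd ℂ) n * m := by
      rw [hm, ← integral_const_mul]
      refine integral_congr_ae (Filter.Eventually.of_forall fun p => ?_)
      ring
    have e3 : m = C * n := by
      rw [hn]
      field_simp
    have e4 : ((starRingEnd ℂ) n * m).re = C * Complex.normSq n := by
      rw [e3]
      simp [Complex.normSq_apply]
      ring
    have e5 : Complex.normSq m = C ^ 2 * Complex.normSq n := by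
      rw [e3]
      simp [Complex.normSq_apply]
      ring
    rw [e1, e2, e4, e5]
    field_simp
    ring
  rw [← hval]
  exact hle

/-- If the mixedness were not almost everywhere zero, some test function would detect it, and the
corresponding classical fluctuation could be split off the state. -/
theorem purityRelation_of_isPureState {γ α : E3 → ℝ} (h : IsEvenPair γ α) {ρ₀ : ℝ}
    (hpure : IsPureState (bogoliubovState γ α ρ₀)) : PurityRelation γ α := by
  rw [bogoliubovState_eq h] at hpure
  have hzero : (∀ f, mixedFunctional h f = 0) → ∀ᵐ p, mixedness γ α p = 0 := by
    intro hall
    -- Real smooth compactly supported functions, viewed as complex Schwartz functions, already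
    -- suffice to detect the weight.
    refine ae_eq_zero_of_integral_contDiff_smul_eq_zero
      (integrable_mixedness h).locallyIntegrable fun g hg hgs => ?_
    have hg' : ContDiff ℝ (⊤ : ℕ∞) fun p => (g p : ℂ) := Complex.ofRealCLM.contDiff.comp hg
    have hgs' : HasCompactSupport fun p => (g p : ℂ) := hgs.comp_left Complex.ofReal_zero
    have h1 := hall (hgs'.toSchwartzMap hg')
    rw [← h1]
    change _ = ∫ p, mixedness γ α p * ((g p : ℂ)).re
    simp only [Complex.ofReal_re, smul_eq_mul, mul_comm]
  have hae : ∀ᵐ p, mixedness γ α p = 0 := by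
    by_contra hne
    obtain ⟨f₀, hf₀⟩ := not_forall.mp (mt hzero hne)
    have hC : 0 < ∫ p, mixedness γ α p := by
      refine lt_of_le_of_ne (integral_nonneg_of_ae (mixedness_nonneg h)) fun h0 => hne ?_
      exact (integral_eq_zero_iff_of_nonneg_ae (mixedness_nonneg h)
        (integrable_mixedness h)).mp h0.symm
    exact not_isPureState_gaussianFunctional (isCovariance_pairKernel h) _ (mixedFunctional h)
      (inv_pos.mpr hC) (posSemidef_reduced_pairKernel h hC) hf₀ hpure
  filter_upwards [hae, h.nonneg] with p h1 h2
  rw [mixedness, div_eq_zero_iff] at h1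
  rcases h1 with h1 | h1 <;> linarith

/-! ### Purity of the states of minimizers -/

theorem isEvenPair_of_mem {γ α : E3 → ℝ} (h : (γ, α) ∈ domainPair) (hγ : IsEvenAE γ)
    (hα : IsEvenAE α) : IsEvenPair γ α where
  integrable := integrable_of_weighted h.1
  measurable := h.2.1
  nonneg := h.2.2.1
  le := h.2.2.2
  even_left := hγ
  even_right := hα

theorem IsMinimalAtDensity.isPureState {V : E3 → ℝ} (hV : Admissible V) {γ α : E3 → ℝ} {ρ₀ : ℝ}
    (h : IsMinimalAtDensity V (γ, α, ρ₀)) :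
    IsPureState (quasiFreeState γ α) ∧ IsPureState (bogoliubovState γ α ρ₀) ∧
      PurityRelation γ α := by
  have hrel := h.purityRelation hV
  have hev := h.even hV
  have hpair := isEvenPair_of_mem h.1.1 hev.1 hev.2
  exact ⟨isPureState_bogoliubovState hpair hrel 0, isPureState_bogoliubovState hpair hrel ρ₀, hrel⟩

end BogoliubovGas

end

theorem corollary2p5 :
    (∀ V : BogoliubovGas.E3 → ℝ, BogoliubovGas.Admissible V →
      (∀ (μ : ℝ) (γ α : BogoliubovGas.E3 → ℝ) (ρ₀ : ℝ),
        BogoliubovGas.IsGrandCanonicalMinimizer V 0 μ (γ, α, ρ₀) →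
          BogoliubovGas.IsPureState (BogoliubovGas.quasiFreeState γ α) ∧
          BogoliubovGas.IsPureState (BogoliubovGas.bogoliubovState γ α ρ₀) ∧
          BogoliubovGas.PurityRelation γ α) ∧
      (∀ (ρ : ℝ), 0 ≤ ρ → ∀ (γ α : BogoliubovGas.E3 → ℝ) (ρ₀ : ℝ),
        BogoliubovGas.IsCanonicalMinimizer V 0 ρ (γ, α, ρ₀) →
          BogoliubovGas.IsPureState (BogoliubovGas.quasiFreeState γ α) ∧
          BogoliubovGas.IsPureState (BogoliubovGas.bogoliubovState γ α ρ₀) ∧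
          BogoliubovGas.PurityRelation γ α)) ∧
    (∀ γ α : BogoliubovGas.E3 → ℝ, (γ, α) ∈ BogoliubovGas.domainPair →
      BogoliubovGas.IsEvenAE γ → BogoliubovGas.IsEvenAE α →
        (BogoliubovGas.IsPureState (BogoliubovGas.quasiFreeState γ α) ↔
          BogoliubovGas.PurityRelation γ α)) := by
  refine ⟨fun V hV => ⟨fun μ γ α ρ₀ h => h.isMinimalAtDensity.isPureState hV,
    fun ρ _ γ α ρ₀ h => h.isMinimalAtDensity.isPureState hV⟩, fun γ α h hγ hα => ?_⟩
  have hpair := BogoliubovGas.isEvenPair_of_mem h hγ hα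
  exact ⟨BogoliubovGas.purityRelation_of_isPureState hpair,
    fun hp => BogoliubovGas.isPureState_bogoliubovState hpair hp 0⟩
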